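/- All $C^*$-algebras are complex and need not be unital; $\mathbb K$ is the algebra of compact operators on a separable infinite-dimensional Hilbert space. A $C^*$-algebra is simple if it is nonzero and has no closed two-sided ideals other than $0$ and itself; it is $\sigma$-unital if it has a countable approximate unit. A trace on a $C^*$-algebra $A$ is an additive, positively homogeneous map $\tau: A_+\to[0,\infty]$ with $\tau(0)=0$ and $\tau(a^*a)=\tau(aa^*)$ for all $a\in A$; it is densely defined if the linear span of $\{a\in A_+:\tau(a)<\infty\}$ is dense in $A$. We say that $A$ has a unique (up to scalar multiple) densely defined lower semicontinuous trace $\tau$ if $\tau$ is a nonzero densely defined lower semicontinuous trace and every densely defined lower semicontinuous trace on $A$ is of the form $c\tau$ with $c\in[0,\infty)$. Let $H_A$ be the standard right Hilbert $A$-module of sequences $(x_n)_{n\in\mathbb N}$ in $A$ for which $\sum_n x_n^*x_n$ converges in norm, with $\langle x,y\rangle_A=\sum_n x_n^*y_n$, and identify $A\otimes\mathbb K$ with the algebra $K_A(H_A)$ of compact operators on $H_A$. A sequence $(\xi_i)$ in $H_A$ is a countable basis if $\eta=\sum_i\xi_i\langle\xi_i,\eta\rangle_A$ in norm for all $\eta\in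 H_A$. For a lower semicontinuous trace $\tau$ on $A$ the induced trace is $\hat\tau(x)=\sum_i\tau(\langle\xi_i,x\xi_i\rangle_A)$, $x\in(A\otimes\mathbb K)_+$, which does not depend on the countable basis $(\xi_i)$ of $H_A$, and $d_\tau(h)=\lim_{n\to\infty}\hat\tau(h^{1/n})$ for $h\in(A\otimes\mathbb K)_+$. If $A$ is simple and $\sigma$-unital with unique (up to scalar multiple) densely defined lower semicontinuous trace $\tau$, its fundamental group is the set $\mathcal F(A)$ of all positive real numbers of the form $d_\tau(h_1)/d_\tau(h_2)$, where $h_1,h_2$ are nonzero positive elements of $A\otimes\mathbb K$ such that $d_\tau(h_2)<\infty$ and $\overline{h_1(A\otimes\mathbb K)h_1}$ is isomorphic to $\overline{h_2(A\otimes\mathbb K)h_2}$ as a $C^*$-algebra. $C^*$-algebras $A$ and $B$ are Morita equivalent if there is an $A$-$B$-equivalence bimodule, that is, an $A$-$B$-bimodule $\mathcal F$ that is both a full left Hilbert $A$-module and a full right Hilbert $B$-module, with ${}_A\langle\xi,\eta\rangle\zeta=\xi\langle\eta,\zeta\rangle_B$ for all $\xi,\eta,\zeta\in\mathcal F$. **Theorem.**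 Let $A$ and $B$ be simple $\sigma$-unital $C^*$-algebras with unique (up to scalar multiple) densely defined lower semicontinuous traces $\tau_A$ and $\tau_B$ respectively. If $A$ is Morita equivalent to $B$, then $\mathcal F(A)=\mathcal F(B)$. -/

import Mathlib

open Filter Topology
open scoped ENNReal NNReal

set_option linter.unusedSectionVars false

namespace CStarFund

section HilbertModule

variable {R E : Type*} [NonUnitalCStarAlgebra R] [PartialOrder R] [StarOrderedRing R]
  [NormedAddCommGroup E] [NormedSpace ℂ E] [SMul R E] [CStarModule R E]

theorem ext_inner {u v : E} (h : ∀ z : E, inner R z u = inner R z v) : u = v := by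
  have h0 : inner R (u - v) (u - v) = 0 := by
    rw [CStarModule.inner_sub_right, h (u - v), sub_self]
  exact sub_eq_zero.mp (CStarModule.inner_self.mp h0)

theorem norm_op_smul_le (r : R) (x : E) : ‖r • x‖ ≤ ‖r‖ * ‖x‖ := by
  have h1 : ‖r • x‖ ^ 2 ≤ (‖r‖ * ‖x‖) ^ 2 := by
    rw [CStarModule.norm_sq_eq R, CStarModule.inner_op_smul_right, CStarModule.inner_op_smul_left,
      mul_pow, CStarModule.norm_sq_eq R (x := x)]
    calc ‖r * (inner R x x * star r)‖ ≤ ‖r‖ * (‖inner R x x‖ * ‖star r‖) :=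
          (norm_mul_le _ _).trans (by gcongr; exact norm_mul_le _ _)
      _ = ‖r‖ ^ 2 * ‖inner R x x‖ := by rw [norm_star]; ring
  exact le_of_sq_le_sq h1 (by positivity)

variable (R E) in
/-- The adjointable operators on a Hilbert `R`-module `E`, as a subalgebra of the bounded
operators on the Banach space `E`. -/
def adjointable : Subalgebra ℂ (E →L[ℂ] E) where
  carrier := {T | ∃ S : E →L[ℂ] E, ∀ x y, inner R (T x) y = inner R x (S y)}
  mul_mem' := by
    rintro a b ⟨a', ha⟩ ⟨b', hb⟩
    exact ⟨b' * a', fun x y => by simp [ha, hb]⟩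
  add_mem' := by
    rintro a b ⟨a', ha⟩ ⟨b', hb⟩
    exact ⟨a' + b', fun x y => by simp [ha, hb]⟩
  algebraMap_mem' c := ⟨algebraMap ℂ _ (star c), fun x y => by
    simp [Algebra.algebraMap_eq_smul_one]⟩

variable (R E) in
/-- The algebra of adjointable operators on a Hilbert `R`-module `E`, with the operator norm. -/
def Adjointable : Type _ := adjointable R E

namespace Adjointable

noncomputable instance : NormedRing (Adjointable R E) :=
  inferInstanceAs (NormedRing (adjointable R E))

noncomputable instance : NormedAlgebra ℂ (Adjointable R E) :=
  inferInstanceAs (NormedAlgebra ℂ (adjointable R E))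

/-- The bounded operator underlying an adjointable operator. -/
def toCLM (T : Adjointable R E) : E →L[ℂ] E := Subtype.val T

theorem toCLM_injective : Function.Injective (toCLM : Adjointable R E → _) :=
  Subtype.val_injective

theorem norm_def (T : Adjointable R E) : ‖T‖ = ‖T.toCLM‖ := rfl

theorem toCLM_add (S T : Adjointable R E) : (S + T).toCLM = S.toCLM + T.toCLM := rfl
theorem toCLM_sub (S T : Adjointable R E) : (S - T).toCLM = S.toCLM - T.toCLM := rfl
theorem toCLM_mul (S T : Adjointable R E) : (S * T).toCLM = S.toCLM * T.toCLM := rfl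
theorem toCLM_smul (c : ℂ) (T : Adjointable R E) : (c • T).toCLM = c • T.toCLM := rfl

/-- The adjoint, which is unique. -/
noncomputable instance : Star (Adjointable R E) where
  star T := ⟨T.2.choose, T.toCLM, fun x y => by
    rw [← CStarModule.star_inner, ← T.2.choose_spec, CStarModule.star_inner]; rfl⟩

theorem inner_left (T : Adjointable R E) (x y : E) :
    inner R (T.toCLM x) y = inner R x ((star T).toCLM y) := T.2.choose_spec x y

theorem inner_right (T : Adjointable R E) (x y : E) :
    inner R x (T.toCLM y) = inner R ((star T).toCLM x) y := by
  rw [← CStarModule.star_inner, inner_left, CStarModule.star_inner]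

theorem star_eq_of {T S : Adjointable R E}
    (h : ∀ x y, inner R (T.toCLM x) y = inner R x (S.toCLM y)) : star T = S := by
  apply toCLM_injective
  ext y
  exact ext_inner (R := R) fun x => by rw [← inner_left, h]

noncomputable instance : StarRing (Adjointable R E) where
  star_involutive T := star_eq_of fun x y => (inner_right T x y).symm
  star_mul S T := star_eq_of fun x y => by
    simp only [toCLM_mul, mul_apply_eq_comp, inner_left]
  star_add S T := star_eq_of fun x y => by
    simp [toCLM_add, inner_left]

instance : StarModule ℂ (Adjointable R E) where
  star_smul c T := star_eq_of fun x y => by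
    simp [toCLM_smul, inner_left]

theorem norm_star_mul_self_ge (T : Adjointable R E) : ‖T‖ * ‖T‖ ≤ ‖star T * T‖ := by
  have key : ‖T‖ ≤ √‖star T * T‖ := by
    rw [norm_def T]
    refine ContinuousLinearMap.opNorm_le_bound _ (Real.sqrt_nonneg _) fun x => ?_
    refine le_of_sq_le_sq ?_ (by positivity)
    rw [mul_pow, Real.sq_sqrt (norm_nonneg _), CStarModule.norm_sq_eq R, inner_left,
      ← mul_apply_eq_comp, ← toCLM_mul]
    calc _ ≤ ‖x‖ * ‖(star T * T).toCLM x‖ := CStarModule.norm_inner_le E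
      _ ≤ ‖x‖ * (‖star T * T‖ * ‖x‖) := by
        gcongr; exact ContinuousLinearMap.le_opNorm _ _
      _ = _ := by ring
  calc ‖T‖ * ‖T‖ ≤ √‖star T * T‖ * √‖star T * T‖ := by gcongr
    _ = _ := Real.mul_self_sqrt (norm_nonneg _)

instance : CStarRing (Adjointable R E) where
  norm_mul_self_le := norm_star_mul_self_ge

instance [CompleteSpace E] : CompleteSpace (Adjointable R E) := by
  refine Metric.complete_of_cauchySeq_tendsto fun u hu => ?_
  have h1 : CauchySeq fun n => (u n).toCLM :=
    uniformContinuous_subtype_val.comp_cauchySeq hu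
  have h2 : CauchySeq fun n => (star (u n)).toCLM :=
    uniformContinuous_subtype_val.comp_cauchySeq
      ((starₗᵢ ℂ (E := Adjointable R E)).isometry.uniformContinuous.comp_cauchySeq hu)
  obtain ⟨T, hT⟩ := cauchySeq_tendsto_of_complete h1
  obtain ⟨S, hS⟩ := cauchySeq_tendsto_of_complete h2
  have hTS : ∀ x y, inner R (T x) y = inner R x (S y) := fun x y => by
    have e1 : Tendsto (fun n => inner R ((u n).toCLM x) y) atTop (𝓝 (inner R (T x) y)) :=
      ((CStarModule.continuous_inner (A := R) (E := E)).tendsto (T x, y)).comp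
        (((ContinuousLinearMap.apply ℂ E x).continuous.tendsto T |>.comp hT).prodMk_nhds
          tendsto_const_nhds)
    have e2 : Tendsto (fun n => inner R x ((star (u n)).toCLM y)) atTop (𝓝 (inner R x (S y))) :=
      ((CStarModule.continuous_inner (A := R) (E := E)).tendsto (x, S y)).comp
        (tendsto_const_nhds.prodMk_nhds
          ((ContinuousLinearMap.apply ℂ E y).continuous.tendsto S |>.comp hS))
    simp only [inner_left] at e1
    exact tendsto_nhds_unique e1 e2
  exact ⟨⟨T, S, hTS⟩, tendsto_subtype_rng.mpr hT⟩

noncomputable instance [CompleteSpace E] : CStarAlgebra (Adjointable R E) where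

end Adjointable

open Adjointable

/-- The continuous linear map `ζ ↦ ⟨η, ζ⟩ • ξ`. -/
noncomputable def rankOneCLM (ξ η : E) : E →L[ℂ] E :=
  LinearMap.mkContinuous
    { toFun := fun ζ => (inner R η ζ : R) • ξ
      map_add' := fun a b => ext_inner (R := R) fun z => by simp [add_mul]
      map_smul' := fun c a => ext_inner (R := R) fun z => by simp [smul_mul_assoc] }
    (‖η‖ * ‖ξ‖) fun ζ => by
      refine (norm_op_smul_le (R := R) _ ξ).trans ?_
      calc ‖(inner R η ζ : R)‖ * ‖ξ‖ ≤ (‖η‖ * ‖ζ‖) * ‖ξ‖ := by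
            gcongr; exact CStarModule.norm_inner_le E
        _ = _ := by ring

variable (R) in
/-- The rank one operator `Θ_{ξ,η} : ζ ↦ ⟨η, ζ⟩ • ξ`. For a right Hilbert module over `A`, that is
for `R = Aᵐᵒᵖ`, this is `ζ ↦ ξ ⟨η, ζ⟩`. -/
noncomputable def rankOne (ξ η : E) : Adjointable R E :=
  ⟨rankOneCLM (R := R) ξ η, rankOneCLM (R := R) η ξ, fun x y => by simp [rankOneCLM]⟩

theorem rankOne_apply (ξ η ζ : E) : (rankOne R ξ η).toCLM ζ = (inner R η ζ : R) • ξ := rfl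

theorem star_rankOne (ξ η : E) : star (rankOne R ξ η) = rankOne R η ξ :=
  star_eq_of fun x y => by simp [rankOne_apply]

theorem rankOne_mul (ξ η ξ' η' : E) :
    rankOne R ξ η * rankOne R ξ' η' = rankOne R ((inner R η ξ' : R) • ξ) η' := by
  apply toCLM_injective
  ext ζ
  exact ext_inner (R := R) fun z => by
    simp [toCLM_mul, rankOne_apply, mul_assoc]

variable (R E) in
/-- The linear span of the rank one operators. -/
noncomputable def rankOneSpan : Submodule ℂ (Adjointable R E) :=
  Submodule.span ℂ {T | ∃ ξ η : E, T = rankOne R ξ η}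

theorem mul_mem_rankOneSpan {S T : Adjointable R E} (hS : S ∈ rankOneSpan R E)
    (hT : T ∈ rankOneSpan R E) : S * T ∈ rankOneSpan R E := by
  induction hS using Submodule.span_induction with
  | mem x hx =>
    obtain ⟨ξ, η, rfl⟩ := hx
    induction hT using Submodule.span_induction with
    | mem y hy =>
      obtain ⟨ξ', η', rfl⟩ := hy
      exact Submodule.subset_span ⟨_, _, rankOne_mul ξ η ξ' η'⟩
    | zero => simp
    | add a b _ _ ha hb => rw [mul_add]; exact add_mem ha hb
    | smul c a _ ha => rw [mul_smul_comm]; exact Submodule.smul_mem _ c ha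
  | zero => simp
  | add a b _ _ ha hb => rw [add_mul]; exact add_mem ha hb
  | smul c a _ ha => rw [smul_mul_assoc]; exact Submodule.smul_mem _ c ha

theorem star_mem_rankOneSpan {T : Adjointable R E} (hT : T ∈ rankOneSpan R E) :
    star T ∈ rankOneSpan R E := by
  induction hT using Submodule.span_induction with
  | mem x hx =>
    obtain ⟨ξ, η, rfl⟩ := hx
    exact Submodule.subset_span ⟨_, _, star_rankOne ξ η⟩
  | zero => simp
  | add a b _ _ ha hb => rw [star_add]; exact add_mem ha hb
  | smul c a _ ha => rw [star_smul]; exact Submodule.smul_mem _ _ ha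

variable (R E) in
/-- The closed linear span of the rank one operators, as a `*`-subalgebra of the adjointable
operators. -/
noncomputable def compacts [CompleteSpace E] : NonUnitalStarSubalgebra ℂ (Adjointable R E) where
  carrier := closure (rankOneSpan R E : Set (Adjointable R E))
  add_mem' := fun ha hb => map_mem_closure₂ continuous_add ha hb fun _ h _ h' => add_mem h h'
  zero_mem' := subset_closure (zero_mem (rankOneSpan R E))
  mul_mem' := fun ha hb =>
    map_mem_closure₂ continuous_mul ha hb fun _ h _ h' => mul_mem_rankOneSpan h h'
  smul_mem' := fun c _ ha =>
    map_mem_closure (continuous_const_smul c) ha fun _ h => Submodule.smul_mem _ c h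
  star_mem' := fun ha => map_mem_closure continuous_star ha fun _ h => star_mem_rankOneSpan h

variable (R E) in
/-- The C⋆-algebra `K(E)` of compact operators on a Hilbert `R`-module `E`: the closure of the
linear span of the rank one operators. -/
def CompactOperators [CompleteSpace E] : Type _ := compacts R E

namespace CompactOperators

variable [CompleteSpace E]

instance : IsClosed (compacts R E : Set (Adjointable R E)) := isClosed_closure

noncomputable instance : NonUnitalCStarAlgebra (CompactOperators R E) :=
  inferInstanceAs (NonUnitalCStarAlgebra (compacts R E))

/-- The usual order: `x ≤ y` if and only if `y - x` is positive. -/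
noncomputable instance : PartialOrder (CompactOperators R E) := CStarAlgebra.spectralOrder _

instance : StarOrderedRing (CompactOperators R E) := CStarAlgebra.spectralOrderedRing _

/-- The inclusion of `K(E)` into the adjointable operators. -/
def toAdjointable (T : CompactOperators R E) : Adjointable R E := Subtype.val T

theorem inner_apply_nonneg {x : CompactOperators R E} (hx : 0 ≤ x) (ξ : E) :
    0 ≤ (inner R ξ (x.toAdjointable.toCLM ξ) : R) := by
  obtain ⟨y, rfl⟩ := CStarAlgebra.nonneg_iff_eq_star_mul_self.mp hx
  have h : (star y * y).toAdjointable = star y.toAdjointable * y.toAdjointable := rfl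
  rw [h, toCLM_mul, mul_apply_eq_comp, ← inner_left]
  exact CStarModule.inner_self_nonneg

end CompactOperators

end HilbertModule

section HilbertSum

variable (R E : Type*) [NonUnitalCStarAlgebra R] [PartialOrder R] [StarOrderedRing R]
  [NormedAddCommGroup E] [NormedSpace ℂ E] [SMul R E] [CStarModule R E]

theorem summable_of_nonneg_of_le {f g : ℕ → R} (hf : ∀ n, 0 ≤ f n) (hfg : ∀ n, f n ≤ g n)
    (hg : Summable g) : Summable f := by
  rw [summable_iff_vanishing_norm] at hg ⊢
  intro ε hε
  obtain ⟨s, hs⟩ := hg ε hε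
  exact ⟨s, fun t ht => (CStarAlgebra.norm_le_norm_of_nonneg_of_le
    (Finset.sum_nonneg fun i _ => hf i) (Finset.sum_le_sum fun i _ => hfg i)).trans_lt (hs t ht)⟩

theorem summable_inner_add {x y : ℕ → E} (hx : Summable fun n => (inner R (x n) (x n) : R))
    (hy : Summable fun n => (inner R (y n) (y n) : R)) :
    Summable fun n => (inner R (x n + y n) (x n + y n) : R) := by
  refine summable_of_nonneg_of_le R (fun n => CStarModule.inner_self_nonneg) (fun n => ?_)
    ((hx.add hx).add (hy.add hy))
  have h : (0 : R) ≤ inner R (x n - y n) (x n - y n) := CStarModule.inner_self_nonneg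
  rw [← sub_nonneg]
  convert h using 1
  simp only [CStarModule.inner_add_left, CStarModule.inner_add_right, CStarModule.inner_sub_left,
    CStarModule.inner_sub_right]
  abel

theorem summable_inner_smul {x : ℕ → E} (c : ℂ)
    (hx : Summable fun n => (inner R (x n) (x n) : R)) :
    Summable fun n => (inner R (c • x n) (c • x n) : R) := by
  simp only [CStarModule.inner_smul_left_complex, CStarModule.inner_smul_right_complex]
  exact (hx.const_smul (star c)).const_smul c

/-- Square summable sequences in `E`: those for which `∑ ⟨xₙ, xₙ⟩` converges in `R`. -/
def sqSummable : Submodule ℂ (ℕ → E) where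
  carrier := {x | Summable fun n => (inner R (x n) (x n) : R)}
  add_mem' := fun hx hy => summable_inner_add R E hx hy
  zero_mem' := by simp
  smul_mem' := fun c _ hx => summable_inner_smul R E c hx

/-- The countably infinite direct sum `E ⊕ E ⊕ ⋯` of copies of a Hilbert `R`-module `E`: sequences
`x` in `E` such that `∑ ⟨xₙ, xₙ⟩` converges in norm. (A series of positive elements converges if
and only if it is unconditionally summable.) -/
def HilbertSum : Type _ := sqSummable R E

namespace HilbertSum

noncomputable instance : AddCommGroup (HilbertSum R E) :=
  inferInstanceAs (AddCommGroup (sqSummable R E))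

noncomputable instance : Module ℂ (HilbertSum R E) :=
  inferInstanceAs (Module ℂ (sqSummable R E))

variable {R E}

/-- The element of the direct sum given by a square summable sequence. -/
def mk (x : ℕ → E) (hx : Summable fun n => (inner R (x n) (x n) : R)) : HilbertSum R E :=
  Subtype.mk x hx

/-- The sequence of coordinates of an element of the direct sum. -/
def coord (x : HilbertSum R E) : ℕ → E := Subtype.val x

instance : CoeFun (HilbertSum R E) fun _ => ℕ → E := ⟨coord⟩

@[simp] theorem mk_apply (x : ℕ → E) (hx : Summable fun n => (inner R (x n) (x n) : R)) (n : ℕ) :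
    mk x hx n = x n := rfl

@[ext] theorem ext {x y : HilbertSum R E} (h : ∀ n, x n = y n) : x = y := Subtype.ext (funext h)

@[simp] theorem add_apply (x y : HilbertSum R E) (n : ℕ) : (x + y) n = x n + y n := rfl
@[simp] theorem sub_apply (x y : HilbertSum R E) (n : ℕ) : (x - y) n = x n - y n := rfl
@[simp] theorem zero_apply (n : ℕ) : (0 : HilbertSum R E) n = 0 := rfl
@[simp] theorem smul_apply (c : ℂ) (x : HilbertSum R E) (n : ℕ) : (c • x) n = c • x n := rfl

theorem summable_self (x : HilbertSum R E) : Summable fun n => (inner R (x n) (x n) : R) := x.2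

theorem summable_inner (x y : HilbertSum R E) : Summable fun n => (inner R (x n) (y n) : R) := by
  have h1 := (((x + y).summable_self.sub x.summable_self).sub y.summable_self)
  have h2 := ((((x + Complex.I • y).summable_self.sub x.summable_self).sub
    y.summable_self)).const_smul Complex.I
  refine ((h1.sub h2).const_smul (2⁻¹ : ℂ)).congr fun n => ?_
  simp only [add_apply, smul_apply, CStarModule.inner_add_left, CStarModule.inner_add_right,
    CStarModule.inner_smul_left_complex, CStarModule.inner_smul_right_complex, smul_sub, smul_add,
    smul_smul]
  simp only [Complex.star_def, Complex.conj_I]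
  match_scalars <;> ring_nf <;> simp [Complex.I_sq, Complex.I_pow_three]
  ring_nf

/-- The action of `R` on the direct sum is coordinatewise. -/
instance : SMul R (HilbertSum R E) where
  smul r x := mk (fun n => r • x n) (by
    refine ((x.summable_self.mul_left r).mul_right (star r)).congr fun n => ?_
    simp [mul_assoc])

@[simp] theorem op_smul_apply (r : R) (x : HilbertSum R E) (n : ℕ) : (r • x) n = r • x n := rfl

/-- The inner product `∑ ⟨xₙ, yₙ⟩` of the direct sum. -/
noncomputable instance : Inner R (HilbertSum R E) where
  inner x y := ∑' n, inner R (x n) (y n)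

theorem inner_def (x y : HilbertSum R E) : (inner R x y : R) = ∑' n, inner R (x n) (y n) := rfl

noncomputable instance : Norm (HilbertSum R E) where
  norm x := √‖(inner R x x : R)‖

noncomputable instance : CStarModule R (HilbertSum R E) where
  inner_add_right {x y z} := by
    simp only [inner_def, add_apply, CStarModule.inner_add_right]
    exact (summable_inner x y).tsum_add (summable_inner x z)
  inner_self_nonneg {x} := tsum_nonneg fun n => CStarModule.inner_self_nonneg
  inner_self {x} := by
    refine ⟨fun h => ?_, fun h => by simp [h, inner_def]⟩
    ext n
    refine CStarModule.inner_self.mp (le_antisymm ?_ (CStarModule.inner_self_nonneg (A := R)))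
    exact (x.summable_self.le_tsum n fun _ _ => CStarModule.inner_self_nonneg).trans_eq h
  inner_op_smul_right {a x y} := by
    simp only [inner_def, op_smul_apply, CStarModule.inner_op_smul_right]
    exact (summable_inner x y).tsum_mul_left a
  inner_smul_right_complex {z x y} := by
    simp only [inner_def, smul_apply, CStarModule.inner_smul_right_complex]
    exact (summable_inner x y).tsum_const_smul z
  star_inner x y := by
    simp only [inner_def]
    refine (tsum_star (f := fun n => (inner R (x n) (y n) : R))).trans ?_
    simp
  norm_eq_sqrt_norm_inner_self x := rfl

noncomputable instance : NormedAddCommGroup (HilbertSum R E) :=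
  NormedAddCommGroup.ofCore (CStarModule.normedSpaceCore R)

noncomputable instance : NormedSpace ℂ (HilbertSum R E) :=
  NormedSpace.ofCore (CStarModule.normedSpaceCore R)

theorem norm_sq (x : HilbertSum R E) : ‖x‖ ^ 2 = ‖∑' n, (inner R (x n) (x n) : R)‖ :=
  CStarModule.norm_sq_eq R

theorem norm_apply_le (x : HilbertSum R E) (n : ℕ) : ‖x n‖ ≤ ‖x‖ := by
  refine le_of_sq_le_sq ?_ (norm_nonneg _)
  rw [norm_sq, CStarModule.norm_sq_eq R]
  exact CStarAlgebra.norm_le_norm_of_nonneg_of_le CStarModule.inner_self_nonneg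
    (x.summable_self.le_tsum n fun _ _ => CStarModule.inner_self_nonneg)

open Classical in
/-- The sequence that agrees with `x` on the finite set `s` and vanishes elsewhere. -/
noncomputable def trunc (s : Finset ℕ) (x : ℕ → E) : HilbertSum R E :=
  mk (fun n => if n ∈ s then x n else 0)
    (summable_of_ne_finset_zero (s := s) fun n hn => by simp [hn])

open Classical in
theorem trunc_apply (s : Finset ℕ) (x : ℕ → E) (n : ℕ) :
    (trunc s x : HilbertSum R E) n = if n ∈ s then x n else 0 := rfl

theorem norm_sq_trunc (s : Finset ℕ) (x : ℕ → E) :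
    ‖(trunc s x : HilbertSum R E)‖ ^ 2 = ‖∑ n ∈ s, (inner R (x n) (x n) : R)‖ := by
  rw [norm_sq, tsum_eq_sum (s := s) fun n hn => by simp [trunc_apply, hn]]
  congr 1
  exact Finset.sum_congr rfl fun n hn => by simp [trunc_apply, hn]

theorem norm_trunc_le (s : Finset ℕ) (x : HilbertSum R E) :
    ‖(trunc s x : HilbertSum R E)‖ ≤ ‖x‖ := by
  refine le_of_sq_le_sq ?_ (norm_nonneg _)
  rw [norm_sq_trunc, norm_sq]
  exact CStarAlgebra.norm_le_norm_of_nonneg_of_le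
    (Finset.sum_nonneg fun n _ => CStarModule.inner_self_nonneg)
    (x.summable_self.sum_le_tsum s fun _ _ => CStarModule.inner_self_nonneg)

theorem trunc_sub (s : Finset ℕ) (x y : ℕ → E) :
    (trunc s (fun n => x n - y n) : HilbertSum R E) = trunc s x - trunc s y := by
  ext n
  simp only [trunc_apply, sub_apply]
  split_ifs <;> simp

theorem norm_trunc_le_of_tendsto {u : ℕ → HilbertSum R E} {x : ℕ → E}
    (hx : ∀ n, Tendsto (fun k => u k n) atTop (𝓝 (x n))) {C : ℝ} (hC : 0 ≤ C)
    (y : HilbertSum R E) (hu : ∀ᶠ k in atTop, ‖u k - y‖ ≤ C) (s : Finset ℕ) :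
    ‖(trunc s (fun n => x n - y n) : HilbertSum R E)‖ ≤ C := by
  refine le_of_sq_le_sq ?_ hC
  rw [norm_sq_trunc]
  have ht : Tendsto (fun k => ‖∑ n ∈ s, (inner R (u k n - y n) (u k n - y n) : R)‖) atTop
      (𝓝 ‖∑ n ∈ s, (inner R (x n - y n) (x n - y n) : R)‖) := by
    refine (tendsto_finsetSum s fun n _ => ?_).norm
    have h := (hx n).sub_const (y n)
    exact ((CStarModule.continuous_inner (A := R) (E := E)).tendsto (x n - y n, x n - y n)).comp (h.prodMk_nhds h)
  refine le_of_tendsto ht (hu.mono fun k hk => ?_)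
  have h := norm_sq_trunc (R := R) s fun n => (u k - y) n
  simp only [sub_apply] at h
  rw [← h]
  gcongr
  exact (norm_trunc_le s (u k - y)).trans hk

instance [CompleteSpace E] : CompleteSpace (HilbertSum R E) := by
  refine Metric.complete_of_cauchySeq_tendsto fun u hu => ?_
  have hc : ∀ n, ∃ l, Tendsto (fun k => u k n) atTop (𝓝 l) := fun n => by
    refine cauchySeq_tendsto_of_complete ?_
    rw [Metric.cauchySeq_iff'] at hu ⊢
    intro ε hε
    obtain ⟨N, hN⟩ := hu ε hε
    refine ⟨N, fun k hk => lt_of_le_of_lt ?_ (hN k hk)⟩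
    rw [dist_eq_norm, dist_eq_norm]
    exact norm_apply_le (u k - u N) n
  choose x hx using hc
  have key : ∀ ε > 0, ∃ N, ∀ k ≥ N, ∀ s,
      ‖(trunc s (fun n => x n - u k n) : HilbertSum R E)‖ ≤ ε := fun ε hε => by
    obtain ⟨N, hN⟩ := Metric.cauchySeq_iff.mp hu ε hε
    refine ⟨N, fun k hk s => norm_trunc_le_of_tendsto hx hε.le (u k) ?_ s⟩
    filter_upwards [eventually_ge_atTop N] with m hm
    rw [← dist_eq_norm]
    exact (hN m hm k hk).le
  have hmem : Summable fun n => (inner R (x n) (x n) : R) := by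
    rw [summable_iff_vanishing_norm]
    intro ε hε
    have hε' : 0 < √ε / 4 := by positivity
    obtain ⟨N, hN⟩ := key _ hε'
    obtain ⟨s, hs⟩ := summable_iff_vanishing_norm.mp (u N).summable_self ((√ε / 4) ^ 2)
      (by positivity)
    refine ⟨s, fun t ht => ?_⟩
    have h1 := hN N le_rfl t
    have h2 : ‖(trunc t (u N) : HilbertSum R E)‖ < √ε / 4 := by
      refine lt_of_pow_lt_pow_left₀ 2 hε'.le ?_
      rw [norm_sq_trunc]
      exact hs t ht
    rw [trunc_sub] at h1
    have h3 : ‖(trunc t x : HilbertSum R E)‖ ≤ √ε / 2 := by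
      have := norm_le_norm_sub_add (trunc t x : HilbertSum R E) (trunc t (u N))
      linarith
    rw [← norm_sq_trunc]
    calc ‖(trunc t x : HilbertSum R E)‖ ^ 2 ≤ (√ε / 2) ^ 2 := by gcongr
      _ = ε / 4 := by rw [div_pow, Real.sq_sqrt hε.le]; norm_num
      _ < ε := by linarith
  refine ⟨mk x hmem, Metric.tendsto_atTop.mpr fun ε hε => ?_⟩
  obtain ⟨N, hN⟩ := key (ε / 2) (by positivity)
  refine ⟨N, fun k hk => ?_⟩
  rw [dist_comm, dist_eq_norm]
  refine lt_of_le_of_lt ?_ (half_lt_self hε)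
  set z : HilbertSum R E := mk x hmem - u k with hz
  refine le_of_sq_le_sq ?_ (by positivity)
  rw [norm_sq]
  refine le_of_tendsto z.summable_self.hasSum.norm (Eventually.of_forall fun s => ?_)
  rw [← norm_sq_trunc]
  gcongr
  exact hN k hk s

end HilbertSum

end HilbertSum

section CStarAlgebra

open MulOpposite

/-- A C⋆-algebra `A` as a right Hilbert module over itself, with `⟨a, b⟩ = a⋆ b`. Right Hilbert
`A`-modules are Hilbert modules over the opposite algebra `Aᵐᵒᵖ`. -/
instance {A : Type*} [NonUnitalCStarAlgebra A] [PartialOrder A] [StarOrderedRing A] :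
    CStarModule Aᵐᵒᵖ A where
  inner a b := op (star a * b)
  inner_add_right := by simp [mul_add]
  inner_self_nonneg {a} := unop_nonneg.mp (star_mul_self_nonneg a)
  inner_self {a} := by simp
  inner_op_smul_right {c a b} := by
    rw [← op_unop c, op_smul_eq_mul, ← op_mul, mul_assoc]
  inner_smul_right_complex {z a b} := by rw [mul_smul_comm, op_smul]
  star_inner a b := by simp [← op_star]
  norm_eq_sqrt_norm_inner_self a := by
    rw [norm_op, CStarRing.norm_star_mul_self, Real.sqrt_mul_self (norm_nonneg a)]

variable (A : Type*) [NonUnitalCStarAlgebra A] [PartialOrder A] [StarOrderedRing A]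

/-- The standard right Hilbert `A`-module `H_A` of sequences `x` in `A` for which `∑ xₙ⋆ xₙ`
converges in norm, with `⟨x, y⟩ = ∑ xₙ⋆ yₙ`. -/
abbrev StandardModule : Type _ := HilbertSum Aᵐᵒᵖ A

/-- The stabilization `A ⊗ 𝕂` of `A`, realized as the C⋆-algebra of compact operators on the
standard right Hilbert `A`-module `H_A`. -/
abbrev Stabilization : Type _ := CompactOperators Aᵐᵒᵖ (StandardModule A)

/-- A C⋆-algebra is simple if it is nonzero and has no closed two-sided ideals other than `0` and
itself. -/
structure IsSimpleCStar : Prop where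
  nontrivial : Nontrivial A
  eq_bot_or_eq_top (I : TwoSidedIdeal A) : IsClosed (I : Set A) → I = ⊥ ∨ I = ⊤

/-- A C⋆-algebra is `σ`-unital if it has a countable approximate unit, that is, an increasing
sequence of positive contractions that is an approximate unit. -/
def IsSigmaUnital : Prop :=
  ∃ u : ℕ → A, Monotone u ∧ (Filter.map u atTop).IsIncreasingApproximateUnit

/-- A trace on a C⋆-algebra `A`: a map `τ : A₊ → [0, ∞]` that is additive and positively
homogeneous, vanishes at `0` and satisfies `τ (a⋆ a) = τ (a a⋆)` for all `a`. -/
structure Trace where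
  /-- The underlying map on positive elements. -/
  toFun : {a : A // 0 ≤ a} → ℝ≥0∞
  map_zero : toFun ⟨0, le_rfl⟩ = 0
  map_add (a b : {a : A // 0 ≤ a}) :
    toFun ⟨a.1 + b.1, add_nonneg a.2 b.2⟩ = toFun a + toFun b
  map_smul (r : ℝ≥0) (a : {a : A // 0 ≤ a}) :
    toFun ⟨(r : ℝ) • a.1, smul_nonneg r.2 a.2⟩ = r * toFun a
  map_star_mul_self (a : A) :
    toFun ⟨star a * a, star_mul_self_nonneg a⟩ = toFun ⟨a * star a, mul_star_self_nonneg a⟩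

variable {A}

instance : CoeFun (Trace A) fun _ => {a : A // 0 ≤ a} → ℝ≥0∞ := ⟨Trace.toFun⟩

namespace Trace

/-- A trace is densely defined if the linear span `M_τ` of the positive elements of finite trace is
dense. -/
def IsDenselyDefined (τ : Trace A) : Prop :=
  Dense (Submodule.span ℂ {a : A | ∃ ha : 0 ≤ a, τ ⟨a, ha⟩ < ∞} : Set A)

/-- `τ` is the unique densely defined lower semicontinuous trace on `A`, up to scalar multiples: it
is a nonzero such trace, and every such trace is a multiple of it. -/
structure IsUnique (τ : Trace A) : Prop where
  ne_zero : ∃ a, τ a ≠ 0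
  denselyDefined : τ.IsDenselyDefined
  lowerSemicontinuous : LowerSemicontinuous τ
  eq_smul (σ : Trace A) : σ.IsDenselyDefined → LowerSemicontinuous σ →
    ∃ c : ℝ≥0, ∀ a, σ a = c * τ a

end Trace

section InducedTrace

variable {X : Type*} [NormedAddCommGroup X] [NormedSpace ℂ X] [SMul Aᵐᵒᵖ X] [CStarModule Aᵐᵒᵖ X]

variable (A) in
/-- A sequence `ξ` in a right Hilbert `A`-module `X` is a countable basis if
`η = ∑ ξᵢ ⟨ξᵢ, η⟩` in norm for all `η` in `X`. -/
def IsCountableBasis (ξ : ℕ → X) : Prop :=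
  ∀ η : X, Tendsto (fun n => ∑ i ∈ Finset.range n, (inner Aᵐᵒᵖ (ξ i) η : Aᵐᵒᵖ) • ξ i) atTop (𝓝 η)

/-- The trace `x ↦ ∑ τ (⟨ξᵢ, x ξᵢ⟩)` on the positive compact operators on a right Hilbert
`A`-module `X` that is induced by a trace `τ` on `A`, where `ξ` is any countable basis of `X`. For
lower semicontinuous `τ` the sum does not depend on the countable basis; to avoid a choice the
definition takes the infimum over all of them. -/
noncomputable def inducedTrace [CompleteSpace X] (τ : Trace A)
    (x : {x : CompactOperators Aᵐᵒᵖ X // 0 ≤ x}) : ℝ≥0∞ :=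
  ⨅ (ξ : ℕ → X) (_ : IsCountableBasis A ξ),
    ∑' i, τ ⟨unop (inner Aᵐᵒᵖ (ξ i) (x.1.toAdjointable.toCLM (ξ i))),
      unop_nonneg.mpr (CompactOperators.inner_apply_nonneg x.2 (ξ i))⟩

end InducedTrace

/-- The dimension function `d_τ (h) = lim τ̂ (h ^ (1 / n))` on the positive elements of `A ⊗ 𝕂`, where
`τ̂` is the trace on `A ⊗ 𝕂 = K(H_A)` induced by `τ`. The sequence converges in `[0, ∞]`, so that its
limit is its upper limit. -/
noncomputable def dimensionFunction (τ : Trace A) (h : {h : Stabilization A // 0 ≤ h}) : ℝ≥0∞ :=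
  limsup (fun n : ℕ => inducedTrace τ ⟨h.1 ^ ((1 : ℝ≥0) / n), CFC.nnrpow_nonneg⟩) atTop

/-- The hereditary C⋆-subalgebra `closure (h C h)` generated by a positive element `h`. -/
def hereditary {C : Type*} [NonUnitalCStarAlgebra C] [PartialOrder C] [StarOrderedRing C]
    (h : {h : C // 0 ≤ h}) : NonUnitalStarSubalgebra ℂ C where
  carrier := closure (Set.range fun x : C => h.1 * x * h.1)
  add_mem' := fun ha hb => map_mem_closure₂ continuous_add ha hb fun _ ⟨x, hx⟩ _ ⟨y, hy⟩ =>
    ⟨x + y, by simp [← hx, ← hy, mul_add, add_mul]⟩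
  zero_mem' := subset_closure ⟨0, by simp⟩
  mul_mem' := fun ha hb => map_mem_closure₂ continuous_mul ha hb fun _ ⟨x, hx⟩ _ ⟨y, hy⟩ =>
    ⟨x * h.1 * (h.1 * y), by simp [← hx, ← hy, mul_assoc]⟩
  smul_mem' := fun c _ ha => map_mem_closure (continuous_const_smul c) ha fun _ ⟨x, hx⟩ =>
    ⟨c • x, by simp [← hx, mul_smul_comm, smul_mul_assoc]⟩
  star_mem' := fun ha => map_mem_closure continuous_star ha fun _ ⟨x, hx⟩ =>
    ⟨star x, by simp [← hx, mul_assoc, (IsSelfAdjoint.of_nonneg h.2).star_eq]⟩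

/-- The fundamental group `F(A)` as a subset of the positive reals: all positive real numbers
`d_τ (h₁) / d_τ (h₂)`, for nonzero positive elements `h₁`, `h₂` of `A ⊗ 𝕂` that generate
isomorphic hereditary subalgebras and satisfy `d_τ (h₂) < ∞`. Here `τ` is the unique densely defined
lower semicontinuous trace of `A`. -/
def fundamentalGroup (τ : Trace A) : Set {r : ℝ // 0 < r} :=
  {r | ∃ h₁ h₂ : {h : Stabilization A // 0 ≤ h}, h₁.1 ≠ 0 ∧ h₂.1 ≠ 0 ∧
    Nonempty (hereditary h₁ ≃⋆ₐ[ℂ] hereditary h₂) ∧ dimensionFunction τ h₂ < ∞ ∧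
    ENNReal.ofReal r.1 = dimensionFunction τ h₁ / dimensionFunction τ h₂}

end CStarAlgebra

section Morita

open MulOpposite

/-- `F` is an `A`-`B`-equivalence bimodule: a full left Hilbert `A`-module and a full right Hilbert
`B`-module with commuting actions and `_A⟨ξ, η⟩ ζ = ξ ⟨η, ζ⟩_B`. As inner products are linear in the
second variable in `CStarModule`, the left inner product `_A⟨ξ, η⟩` is `inner A η ξ`. The two
inner products of an equivalence bimodule always define the same norm, here the norm of `F`. -/
structure IsEquivalenceBimodule (A B F : Type*)
    [NonUnitalCStarAlgebra A] [PartialOrder A] [StarOrderedRing A]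
    [NonUnitalCStarAlgebra B] [PartialOrder B] [StarOrderedRing B]
    [NormedAddCommGroup F] [NormedSpace ℂ F] [CompleteSpace F] [SMul A F] [SMul Bᵐᵒᵖ F]
    [CStarModule A F] [CStarModule Bᵐᵒᵖ F] : Prop where
  smul_comm (a : A) (b : B) (ξ : F) : a • (op b • ξ) = op b • (a • ξ)
  inner_smul (ξ η ζ : F) : (inner A η ξ : A) • ζ = (inner Bᵐᵒᵖ η ζ : Bᵐᵒᵖ) • ξ
  full_left : Dense (Submodule.span ℂ {a : A | ∃ ξ η : F, a = inner A η ξ} : Set A)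
  full_right :
    Dense (Submodule.span ℂ {b : B | ∃ ξ η : F, b = unop (inner Bᵐᵒᵖ ξ η)} : Set B)

universe u v w

/-- `A` and `B` are Morita equivalent if there is an `A`-`B`-equivalence bimodule. -/
def MoritaEquivalent (A : Type u) (B : Type v)
    [NonUnitalCStarAlgebra A] [PartialOrder A] [StarOrderedRing A]
    [NonUnitalCStarAlgebra B] [PartialOrder B] [StarOrderedRing B] : Prop :=
  ∃ (F : Type w) (_ : NormedAddCommGroup F) (_ : NormedSpace ℂ F) (_ : CompleteSpace F)
    (_ : SMul A F) (_ : SMul Bᵐᵒᵖ F) (_ : CStarModule A F) (_ : CStarModule Bᵐᵒᵖ F),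
    IsEquivalenceBimodule A B F

end Morita

end CStarFund

universe u v w

set_option linter.unusedSectionVars false

/-! Let `F` be the bimodule and `F^∞ = F ⊕ F ⊕ ⋯`. The tensor product `H_A ⊗ F` is `F^∞`, with `ζ ⊗
f = (ζₙ f)`, and `T ↦ T ⊗ 1` identifies `A ⊗ 𝕂` with `K(F^∞)` (`exists_starHom_tensor`). Since `A`
is `σ`-unital, `F` has a Parseval frame, hence `F^∞` embeds isometrically into `H_B`; since `B` is
`σ`-unital and `F` is full over `B`, also `H_B` embeds isometrically into `F^∞`. An isometry `V` of
Hilbert modules induces an injection `T ↦ V T V⋆` of compact operators with hereditary range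
(`exists_starHom_of_isometry`). Thus `A ⊗ 𝕂` and `B ⊗ 𝕂` embed into each other as hereditary
subalgebras, and no stable isomorphism is needed.

Such an embedding respects roots and generated hereditary subalgebras. If it also multiplies the
induced traces by a nonzero constant, the constant cancels in `d_τ(h₁) / d_τ(h₂)` and one
fundamental group is contained in the other (`fundamentalGroup_subset`).

The constant comes from uniqueness of the trace. For a Parseval frame `ξ` of `F`, `σ(a) = ∑ τ_B(⟨ξᵢ,
a ξᵢ⟩_B)` is a densely defined lower semicontinuous trace on `A`, so `σ = c τ_A`, while `σ(_A⟨f, f⟩)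
= τ_B(⟨f, f⟩_B)` (`exists_scalar`).

To pass to induced traces, positive elements are expanded into series from a conjugation invariant
cone (`IsConjCone.exists_hasSum`). If `x = ∑ θ_{ζⱼ,ζⱼ}`, its induced trace is `∑ τ(⟨ζⱼ, ζⱼ⟩)`
(`inducedTrace_eq`). In `K(F^∞)` the `ζⱼ` can be chosen to be elementary tensors
(`isConjCone_theta_tensor`), on which the two traces are compared directly (`trace_tensor`). -/

namespace CStarFund

/-! ### Convergence of series of positive elements -/

section PositiveSeries

variable {C : Type*} [NonUnitalCStarAlgebra C] [PartialOrder C] [StarOrderedRing C]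

/-- Remainders decrease along finite sets and the norm is monotone on positive elements, so one
small remainder controls all later ones. -/
theorem hasSum_of_nonneg_of_norm_sub_lt {ι : Type*} {f : ι → C} {a : C} (hf : ∀ i, 0 ≤ f i)
    (hle : ∀ s : Finset ι, ∑ i ∈ s, f i ≤ a)
    (happ : ∀ ε > 0, ∃ s : Finset ι, ‖a - ∑ i ∈ s, f i‖ < ε) : HasSum f a := by
  classical
  refine Metric.tendsto_atTop.mpr fun ε hε => ?_
  obtain ⟨s, hs⟩ := happ ε hε
  refine ⟨s, fun t ht => ?_⟩
  rw [dist_comm, dist_eq_norm]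
  exact (CStarAlgebra.norm_le_norm_of_nonneg_of_le (sub_nonneg.mpr (hle t))
    (sub_le_sub_left (Finset.sum_le_sum_of_subset_of_nonneg ht fun i _ _ => hf i) a)).trans_lt hs

theorem hasSum_of_nonneg_of_tendsto_sum_range {f : ℕ → C} {a : C} (hf : ∀ i, 0 ≤ f i)
    (h : Tendsto (fun n => ∑ i ∈ Finset.range n, f i) atTop (𝓝 a)) : HasSum f a := by
  refine hasSum_of_nonneg_of_norm_sub_lt hf (fun s => ?_) fun ε hε => ?_
  · obtain ⟨N, hN⟩ := s.exists_nat_subset_range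
    refine ge_of_tendsto h ?_
    filter_upwards [eventually_ge_atTop N] with n hn
    exact Finset.sum_le_sum_of_subset_of_nonneg
      (hN.trans (Finset.range_mono hn)) fun i _ _ => hf i
  · obtain ⟨n, hn⟩ := (Metric.tendsto_atTop.mp h ε hε)
    refine ⟨Finset.range n, ?_⟩
    rw [← dist_eq_norm, dist_comm]
    exact hn n le_rfl

/-- Tonelli for positive double series: every finite partial sum is dominated by one over a
rectangle, and rectangles approximate the iterated sum. -/
theorem hasSum_prod_of_nonneg {ι κ : Type*} {f : ι × κ → C} {g : ι → C} {a : C}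
    (hf : ∀ i, 0 ≤ f i) (hfg : ∀ i, HasSum (fun k => f (i, k)) (g i)) (hg : HasSum g a) :
    HasSum f a := by
  classical
  have hg0 : ∀ i, 0 ≤ g i := fun i => (hfg i).nonneg fun k => hf _
  refine hasSum_of_nonneg_of_norm_sub_lt hf (fun s => ?_) fun ε hε => ?_
  · calc ∑ x ∈ s, f x ≤ ∑ x ∈ (s.image Prod.fst) ×ˢ (s.image Prod.snd), f x :=
          Finset.sum_le_sum_of_subset_of_nonneg
            (fun x hx => Finset.mem_product.mpr
              ⟨Finset.mem_image_of_mem _ hx, Finset.mem_image_of_mem _ hx⟩) fun i _ _ => hf i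
      _ = ∑ i ∈ s.image Prod.fst, ∑ k ∈ s.image Prod.snd, f (i, k) := Finset.sum_product _ _ _
      _ ≤ ∑ i ∈ s.image Prod.fst, g i :=
          Finset.sum_le_sum fun i _ => sum_le_hasSum _ (fun k _ => hf _) (hfg i)
      _ ≤ a := sum_le_hasSum _ (fun k _ => hg0 _) hg
  · obtain ⟨s, hs⟩ := Metric.tendsto_atTop.mp hg (ε / 2) (by positivity)
    have h1 : Tendsto (fun t : Finset κ => ∑ i ∈ s, ∑ k ∈ t, f (i, k)) atTop (𝓝 (∑ i ∈ s, g i)) :=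
      tendsto_finsetSum _ fun i _ => hfg i
    obtain ⟨t, ht⟩ := Metric.tendsto_atTop.mp h1 (ε / 2) (by positivity)
    refine ⟨s ×ˢ t, ?_⟩
    rw [Finset.sum_product, ← dist_eq_norm]
    have h2 := hs s le_rfl
    have h3 := ht t le_rfl
    rw [dist_comm] at h2 h3
    linarith [dist_triangle a (∑ i ∈ s, g i) (∑ i ∈ s, ∑ k ∈ t, f (i, k))]

end PositiveSeries

/-! ### Decomposition of positive elements along a cone -/

section Decomposition

variable {C : Type*} [NonUnitalCStarAlgebra C] [PartialOrder C] [StarOrderedRing C]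

/-- A set of positive elements that contains `0`, is invariant under conjugation and nonnegative
scalars, and has dense linear span. -/
structure IsConjCone (P : Set C) : Prop where
  zero_mem : (0 : C) ∈ P
  nonneg : ∀ p ∈ P, 0 ≤ p
  conj : ∀ c, ∀ p ∈ P, c * p * star c ∈ P
  smul : ∀ r : ℝ, 0 ≤ r → ∀ p ∈ P, r • p ∈ P
  dense : Dense (Submodule.span ℂ P : Set C)

/-- With `b = w + ε`, take `c = a^{1/2} b^{-1/2}`. Then `a - c w c⋆ = ε c c⋆`, which is positive,
and `‖c c⋆‖ = ‖c⋆ c‖ = ‖b^{-1/2} a b^{-1/2}‖ ≤ 1`. -/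
theorem exists_conj_le_of_le_add {a w : C} (ha : 0 ≤ a) (hw : 0 ≤ w) {ε : ℝ} (hε : 0 < ε)
    (h : (a : Unitization ℂ C) ≤ w + algebraMap ℝ (Unitization ℂ C) ε) :
    ∃ c : C, c * w * star c ≤ a ∧ ‖a - c * w * star c‖ ≤ ε := by
  set U := Unitization ℂ C
  set b : U := w + algebraMap ℝ U ε with hb
  have hw' : (0 : U) ≤ w := Unitization.inr_nonneg_iff.mpr hw
  have hbpos : IsStrictlyPositive b :=
    IsStrictlyPositive.nonneg_add hw' (isStrictlyPositive_algebraMap hε)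
  set v : U := b ^ (-(1 / 2) : ℝ) with hv
  have hv0 : 0 ≤ v := CFC.rpow_nonneg
  have hvs : star v = v := (IsSelfAdjoint.of_nonneg hv0).star_eq
  have hvbv : v * b * v = 1 := CFC.conjugate_rpow_neg_one_half b
  set s : C := CFC.sqrt a with hs
  have hss : s * s = a := CFC.sqrt_mul_sqrt_self a
  have hs' : star s = s := (IsSelfAdjoint.of_nonneg (CFC.sqrt_nonneg a)).star_eq
  -- The inverse root lives in the unitization, but `C` is an ideal there, so the product with `s`
  -- lies in `C`.
  obtain ⟨c, hc⟩ : ∃ c : C, (c : U) = s * v := by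
    refine ⟨((s : U) * v).snd, ?_⟩
    ext
    · exact (by rw [Unitization.fst_mul]; simp : (0 : ℂ) = ((s : U) * v).fst)
    · rfl
  have hcs : ((star c : C) : U) = v * s := by
    rw [Unitization.inr_star, hc, star_mul, hvs, ← Unitization.inr_star, hs']
  have hkey : (a : U) - (c * w * star c : C) = ε • ((c * star c : C) : U) := by
    have e1 : (w : U) = b - algebraMap ℝ U ε := by simp [hb]
    have e2 : v * (w : U) * v = 1 - ε • (v * v) := by
      rw [e1, mul_sub, sub_mul, hvbv, Algebra.algebraMap_eq_smul_one]
      simp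
    have e3 : ((c * w * star c : C) : U) = s * (v * w * v) * s := by
      simp only [Unitization.inr_mul, hcs, hc, mul_assoc]
    rw [e3, e2, Unitization.inr_mul, hcs, hc, mul_sub, sub_mul, mul_one, ← Unitization.inr_mul,
      hss]
    simp [mul_assoc]
  have hkey' : a - c * w * star c = ε • (c * star c) := by
    apply Unitization.inr_injective (R := ℂ)
    rw [Unitization.inr_sub, hkey, Unitization.inr_smul]
  have hcn : ‖c * star c‖ ≤ 1 := by
    rw [CStarRing.norm_self_mul_star, ← CStarRing.norm_star_mul_self, ← Unitization.norm_inr (𝕜 := ℂ),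
      Unitization.inr_mul, hcs, hc, show v * (s : U) * (s * v) = v * a * v by
        rw [← hss, Unitization.inr_mul]; simp only [mul_assoc]]
    have h0 : 0 ≤ v * (a : U) * v :=
      conjugate_nonneg_of_nonneg (Unitization.inr_nonneg_iff.mpr ha) hv0
    rw [CStarAlgebra.norm_le_one_iff_of_nonneg _ h0, ← hvbv]
    exact conjugate_le_conjugate_of_nonneg h hv0
  refine ⟨c, ?_, ?_⟩
  · rw [← sub_nonneg, hkey']
    exact smul_nonneg hε.le (mul_star_self_nonneg c)
  · rw [hkey', norm_smul, Real.norm_of_nonneg hε.le]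
    exact mul_le_of_le_one_right hε.le hcn

theorem IsConjCone.nonneg_of_mem_closure {P : Set C} (hP : IsConjCone P) {w : C}
    (hw : w ∈ AddSubmonoid.closure P) : 0 ≤ w :=
  AddSubmonoid.closure_le (S := AddSubmonoid.nonneg C).mpr hP.nonneg hw

/-- Approximate `a` by a combination of elements of `P`, drop the imaginary parts of the
coefficients (`a` is self-adjoint) and replace the real parts by their absolute values, which only
enlarges the sum. -/
theorem IsConjCone.exists_le_add {P : Set C} (hP : IsConjCone P) {a : C} (ha : 0 ≤ a) {ε : ℝ}
    (hε : 0 < ε) : ∃ w ∈ AddSubmonoid.closure P,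
      (a : Unitization ℂ C) ≤ w + algebraMap ℝ (Unitization ℂ C) ε := by
  obtain ⟨z, hz, hzε⟩ := Metric.mem_closure_iff.mp (hP.dense a) ε hε
  obtain ⟨n, c, p, rfl⟩ := Submodule.mem_span_set'.mp hz
  set z := ∑ i, c i • (p i : C) with hzdef
  have hps : ∀ i, star (p i : C) = p i := fun i =>
    (IsSelfAdjoint.of_nonneg (hP.nonneg _ (p i).2)).star_eq
  refine ⟨∑ i, |(c i).re| • (p i : C), sum_mem fun i _ => AddSubmonoid.subset_closure
    (hP.smul _ (abs_nonneg _) _ (p i).2), ?_⟩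
  set w := ∑ i, |(c i).re| • (p i : C)
  have hre : (realPart z : C) = ∑ i, (c i).re • (p i : C) := by
    rw [realPart_apply_coe, hzdef, star_sum, ← Finset.sum_add_distrib, Finset.smul_sum]
    refine Finset.sum_congr rfl fun i _ => ?_
    rw [star_smul, hps, ← add_smul, Complex.star_def, Complex.add_conj]
    simp only [← Complex.coe_smul, smul_smul]
    congr 1
    push_cast
    ring
  have hzw : (realPart z : C) ≤ w := by
    rw [hre]
    exact Finset.sum_le_sum fun i _ =>
      smul_le_smul_of_nonneg_right (le_abs_self _) (hP.nonneg _ (p i).2)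
  have hae : ‖a - (realPart z : C)‖ ≤ ε := by
    have e1 : a - (realPart z : C) = (realPart (a - z) : C) := by
      rw [map_sub, AddSubgroupClass.coe_sub, (IsSelfAdjoint.of_nonneg ha).coe_realPart]
    rw [e1]
    refine (realPart.norm_le (a - z)).trans ?_
    rw [← dist_eq_norm]
    exact hzε.le
  have hsa : IsSelfAdjoint ((a - (realPart z : C) : C) : Unitization ℂ C) :=
    ((IsSelfAdjoint.of_nonneg ha).sub (realPart z).2).inr ℂ
  have h1 := hsa.le_algebraMap_norm_self
  rw [Unitization.norm_inr, Unitization.inr_sub, sub_le_iff_le_add'] at h1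
  refine h1.trans (add_le_add ?_ ?_)
  · exact (Unitization.inr_le_iff _ _ (realPart z).2
      (IsSelfAdjoint.of_nonneg (Finset.sum_nonneg fun i _ => smul_nonneg (abs_nonneg _)
        (hP.nonneg _ (p i).2)))).mpr hzw
  · rw [Algebra.algebraMap_eq_smul_one, Algebra.algebraMap_eq_smul_one]
    exact smul_le_smul_of_nonneg_right hae zero_le_one

/-- The majorant of `a + ε` type is cut down below `a` by a conjugation, which keeps it a finite sum
of elements of `P`. -/
theorem IsConjCone.exists_mem_closure_le {P : Set C} (hP : IsConjCone P) {a : C} (ha : 0 ≤ a)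
    {ε : ℝ} (hε : 0 < ε) : ∃ y ∈ AddSubmonoid.closure P, y ≤ a ∧ ‖a - y‖ ≤ ε := by
  obtain ⟨w, hw, haw⟩ := hP.exists_le_add ha hε
  have hw0 : 0 ≤ w := hP.nonneg_of_mem_closure hw
  obtain ⟨c, hc1, hc2⟩ := exists_conj_le_of_le_add ha hw0 hε haw
  refine ⟨_, ?_, hc1, hc2⟩
  clear haw hw0 hc1 hc2
  induction hw using AddSubmonoid.closure_induction with
  | mem x hx => exact AddSubmonoid.subset_closure (hP.conj c x hx)
  | zero => simp
  | add x y _ _ hx hy => rw [mul_add, add_mul]; exact add_mem hx hy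

/-- Every positive element is the sum of a series of elements of a conjugation invariant cone. -/
theorem IsConjCone.exists_hasSum {P : Set C} (hP : IsConjCone P) {a : C} (ha : 0 ≤ a) :
    ∃ p : ℕ → C, (∀ i, p i ∈ P) ∧ HasSum p a := by
  have step : ∀ (n : ℕ) (b : {b : C // 0 ≤ b}), ∃ y ∈ AddSubmonoid.closure P, y ≤ b.1 ∧
      ‖b.1 - y‖ ≤ 1 / ((n : ℝ) + 1) := fun n b =>
    hP.exists_mem_closure_le b.2 (by positivity)
  choose y hyP hyle hyn using step
  -- Greedy subtraction: `r n` is what remains of `a` after `n` stages. The tolerance `1 / (n + 1)`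
  -- depends on the stage only, so the remainders tend to `0`.
  let r : ℕ → {b : C // 0 ≤ b} := fun n =>
    Nat.rec ⟨a, ha⟩ (fun n b => ⟨b.1 - y n b, sub_nonneg.mpr (hyle n b)⟩) n
  have hr : ∀ n, (r (n + 1)).1 = (r n).1 - y n (r n) := fun n => rfl
  have hsum : ∀ n, ∑ i ∈ Finset.range n, y i (r i) = a - (r n).1 := fun n => by
    induction n with
    | zero => simp [r]
    | succ n ih => rw [Finset.sum_range_succ, ih, hr]; abel
  have hlim : Tendsto (fun n => ∑ i ∈ Finset.range n, y i (r i)) atTop (𝓝 a) := by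
    rw [← tendsto_add_atTop_iff_nat 1]
    simp only [hsum]
    have h0 : Tendsto (fun n => (r (n + 1)).1) atTop (𝓝 0) :=
      squeeze_zero_norm (fun n => hyn n (r n)) tendsto_one_div_add_atTop_nhds_zero_nat
    simpa using h0.const_sub a
  have hy0 : ∀ i, 0 ≤ y i (r i) := fun i => hP.nonneg_of_mem_closure (hyP _ _)
  have hrow : ∀ i, ∃ p : ℕ → C, (∀ j, p j ∈ P) ∧ HasSum p (y i (r i)) := fun i => by
    obtain ⟨l, hl, hls⟩ := AddSubmonoid.exists_list_of_mem_closure (hyP i (r i))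
    -- The finite sum is padded to a sequence by `0`, which belongs to `P`.
    refine ⟨fun j => l.getD j 0, fun j => ?_, ?_⟩
    · change l.getD j 0 ∈ P
      by_cases hj : j < l.length
      · rw [List.getD_eq_getElem _ _ hj]
        exact hl _ (List.getElem_mem hj)
      · rw [List.getD_eq_default _ _ (not_lt.mp hj)]
        exact hP.zero_mem
    · have h1 := hasSum_sum_of_ne_finset_zero (f := fun j => l.getD j 0)
        (s := Finset.range l.length) (L := SummationFilter.unconditional ℕ) fun j hj =>
          List.getD_eq_default _ _ (by simpa using hj)
      convert h1 using 1
      rw [← hls, Finset.sum_range, ← Fin.sum_univ_getElem]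
      simp
  choose p hpP hps using hrow
  have h2 : HasSum (fun x : ℕ × ℕ => p x.1 x.2) a :=
    hasSum_prod_of_nonneg (fun x => hP.nonneg _ (hpP _ _)) hps
      (hasSum_of_nonneg_of_tendsto_sum_range hy0 hlim)
  refine ⟨fun n => p (Nat.pairEquiv.symm n).1 (Nat.pairEquiv.symm n).2, fun n => hpP _ _, ?_⟩
  exact (Equiv.hasSum_iff Nat.pairEquiv.symm (f := fun x : ℕ × ℕ => p x.1 x.2)).mpr h2

/-- In a `σ`-unital C⋆-algebra, a series of elements of a conjugation invariant cone converges
strictly to the identity. -/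
theorem IsConjCone.exists_strict_unit {P : Set C} (hP : IsConjCone P) (hC : IsSigmaUnital C) :
    ∃ (p : ℕ × ℕ → C) (d : ℕ → C), (∀ i, p i ∈ P) ∧ (∀ n, 0 ≤ d n) ∧
      (∀ n, HasSum (fun j => p (n, j)) (d n)) ∧
      (map (fun n => ∑ i ∈ Finset.range n, d i) atTop).IsApproximateUnit := by
  obtain ⟨u, hu, hua⟩ := hC
  obtain ⟨N, hN⟩ := eventually_atTop.mp (eventually_map.mp hua.eventually_nonneg)
  -- Increments of the approximate unit, starting at an index `N` from which it is positive; they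
  -- telescope to `u (N + n)`.
  have hd : ∀ n, 0 ≤ (if n = 0 then u N else u (N + n) - u (N + n - 1)) := fun n => by
    split_ifs with h
    · exact hN N le_rfl
    · exact sub_nonneg.mpr (hu (Nat.sub_le _ _))
  choose p hpP hps using fun n => hP.exists_hasSum (hd n)
  refine ⟨fun x => p x.1 x.2, _, fun x => hpP _ _, hd, hps, ?_⟩
  have hsum : ∀ n, ∑ i ∈ Finset.range (n + 1),
      (if i = 0 then u N else u (N + i) - u (N + i - 1)) = u (N + n) := fun n => by
    induction n with
    | zero => simp
    | succ n ih => rw [Finset.sum_range_succ, ih]; simp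
  rw [← map_add_atTop_eq_nat 1, map_map]
  have h3 : (fun n => ∑ i ∈ Finset.range n,
      (if i = 0 then u N else u (N + i) - u (N + i - 1))) ∘ (fun n => n + 1) =
      u ∘ fun n => N + n := funext hsum
  rw [h3, ← map_map]
  have hle : map u (map (fun n => N + n) atTop) ≤ map u atTop :=
    map_mono (tendsto_add_atTop_nat N |>.congr fun n => add_comm _ _)
  exact ⟨fun m => (hua.tendsto_mul_left m).mono_left hle,
    fun m => (hua.tendsto_mul_right m).mono_left hle⟩

end Decomposition

/-! ### Homomorphisms of C⋆-algebras and hereditary subalgebras -/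

section Morphisms

variable {C D : Type*} [NonUnitalCStarAlgebra C] [NonUnitalCStarAlgebra D]

theorem range_isClosed_of_injective (φ : C →⋆ₙₐ[ℂ] D) (hφ : Function.Injective φ) :
    IsClosed (Set.range φ) :=
  (NonUnitalStarAlgHom.isometry φ hφ).isClosedEmbedding.isClosed_range

/-- A closed `*`-subalgebra of `C × D` that meets both factors trivially and projects to a dense
subset of `C` is the graph of an injective `*`-homomorphism. -/
theorem exists_starHom_of_graph (S : NonUnitalStarSubalgebra ℂ (C × D))
    (hS : IsClosed (S : Set (C × D))) (h₁ : ∀ c, (c, (0 : D)) ∈ S → c = 0)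
    (h₂ : ∀ d, ((0 : C), d) ∈ S → d = 0) (hd : Dense (Prod.fst '' (S : Set (C × D)))) :
    ∃ φ : C →⋆ₙₐ[ℂ] D, Function.Injective φ ∧ ∀ c d, (c, d) ∈ S ↔ φ c = d := by
  have := hS
  let f : S →⋆ₙₐ[ℂ] C := (NonUnitalStarAlgHom.fst ℂ C D).comp (NonUnitalStarSubalgebraClass.subtype S)
  let g : S →⋆ₙₐ[ℂ] D := (NonUnitalStarAlgHom.snd ℂ C D).comp (NonUnitalStarSubalgebraClass.subtype S)
  have hf : Function.Injective f := by
    rw [injective_iff_map_eq_zero]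
    rintro ⟨⟨c, d⟩, h⟩ (h0 : c = 0)
    subst h0
    have := h₂ d h
    subst this
    rfl
  have hg : Function.Injective g := by
    rw [injective_iff_map_eq_zero]
    rintro ⟨⟨c, d⟩, h⟩ (h0 : d = 0)
    subst h0
    have := h₁ c h
    subst this
    rfl
  -- An injective `*`-homomorphism has closed range, so density of the projection gives
  -- surjectivity.
  have hfs : Function.Surjective f := by
    rw [← Set.range_eq_univ, ← (range_isClosed_of_injective f hf).closure_eq]
    have : Set.range f = Prod.fst '' (S : Set (C × D)) := by
      ext c
      constructor
      · rintro ⟨x, rfl⟩; exact ⟨x.1, x.2, rfl⟩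
      · rintro ⟨x, hx, rfl⟩; exact ⟨⟨x, hx⟩, rfl⟩
    rw [this]
    exact hd.closure_eq
  let e : S ≃⋆ₐ[ℂ] C := StarAlgEquiv.ofBijective f ⟨hf, hfs⟩
  have he : ∀ c, (c, g (e.symm c)) ∈ S := fun c => by
    have h1 : f (e.symm c) = c := e.apply_symm_apply c
    have h2 : (f (e.symm c), g (e.symm c)) ∈ S := (e.symm c).2
    rwa [h1] at h2
  refine ⟨g.comp (e.symm : C →⋆ₙₐ[ℂ] S), hg.comp e.symm.injective, fun c d => ⟨fun h => ?_, ?_⟩⟩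
  · have := S.sub_mem h (he c)
    rw [Prod.mk_sub_mk, sub_self] at this
    exact (sub_eq_zero.mp (h₂ _ this)).symm
  · rintro rfl
    exact he c

section Order

variable [PartialOrder C] [StarOrderedRing C] [PartialOrder D] [StarOrderedRing D]

theorem starHom_nonneg (φ : C →⋆ₙₐ[ℂ] D) {a : C} (ha : 0 ≤ a) : 0 ≤ φ a := by
  obtain ⟨y, rfl⟩ := CStarAlgebra.nonneg_iff_eq_star_mul_self.mp ha
  rw [map_mul, map_star]
  exact star_mul_self_nonneg _

theorem starHom_nnrpow (φ : C →⋆ₙₐ[ℂ] D) (hφ : Function.Injective φ) {a : C} (ha : 0 ≤ a)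
    (r : ℝ≥0) : φ (a ^ r) = φ a ^ r := by
  rcases eq_or_ne r 0 with rfl | hr
  -- The non-unital calculus needs functions vanishing at `0`, and `a ^ 0` is `0` there. This
  -- exponent does occur: the term `n = 0` in `dimensionFunction` has exponent `1 / 0 = 0`.
  · simp [CFC.nnrpow_zero]
  · have hr' : (r : ℝ) ≠ 0 := by exact_mod_cast hr
    rw [CFC.nnrpow_def, CFC.nnrpow_def]
    exact NonUnitalStarAlgHom.map_cfcₙ φ _ a
      (NNReal.continuous_nnrpow_const r).continuousOn (by simp [hr'])
      (NonUnitalStarAlgHom.isometry φ hφ).continuous ha (starHom_nonneg φ ha)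

/-- The range of `φ` is a hereditary subalgebra. -/
def HasHereditaryRange (φ : C →⋆ₙₐ[ℂ] D) : Prop :=
  ∀ c c' d, φ c * d * φ c' ∈ Set.range φ

/-- For an approximate unit `u` of `C`, `φ(h) d φ(h)` is the limit of `φ(h) φ(u) d φ(u) φ(h)`, and
hereditary range puts `φ(u) d φ(u)` in the image of `φ`. -/
theorem map_hereditary (φ : C →⋆ₙₐ[ℂ] D) (hφ : Function.Injective φ)
    (hr : HasHereditaryRange φ) (h : {h : C // 0 ≤ h}) :
    φ '' (hereditary h : Set C) = hereditary ⟨φ h.1, starHom_nonneg φ h.2⟩ := by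
  have hiso := NonUnitalStarAlgHom.isometry φ hφ
  have e : φ '' (hereditary h : Set C) = closure (φ '' Set.range fun x : C => h.1 * x * h.1) :=
    hiso.isClosedEmbedding.closure_image_eq _ |>.symm
  rw [e]
  apply subset_antisymm
  · refine closure_mono ?_
    rintro _ ⟨_, ⟨x, rfl⟩, rfl⟩
    exact ⟨φ x, by simp⟩
  · refine closure_minimal ?_ isClosed_closure
    rintro _ ⟨d, rfl⟩
    have hua := CStarAlgebra.increasingApproximateUnit C
    have := hua.neBot
    have h1 : Tendsto (fun u => φ (h.1 * u) * d * φ (u * h.1)) (CStarAlgebra.approximateUnit C)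
        (𝓝 (φ h.1 * d * φ h.1)) :=
      (((hiso.continuous.tendsto _).comp (hua.tendsto_mul_left h.1)).mul tendsto_const_nhds).mul
        ((hiso.continuous.tendsto _).comp (hua.tendsto_mul_right h.1))
    refine mem_closure_of_tendsto h1 (Eventually.of_forall fun u => ?_)
    obtain ⟨z, hz⟩ := hr u u d
    exact ⟨h.1 * z * h.1, ⟨z, rfl⟩, by simp only [map_mul, hz, mul_assoc]⟩

/-- An injective homomorphism with hereditary range identifies hereditary subalgebras. -/
theorem nonempty_hereditary_equiv (φ : C →⋆ₙₐ[ℂ] D) (hφ : Function.Injective φ)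
    (hr : HasHereditaryRange φ) (h : {h : C // 0 ≤ h}) :
    Nonempty (hereditary h ≃⋆ₐ[ℂ] hereditary (⟨φ h.1, starHom_nonneg φ h.2⟩ : {d : D // 0 ≤ d})) := by
  have himg := map_hereditary φ hφ hr h
  let f : hereditary h →⋆ₙₐ[ℂ] hereditary (⟨φ h.1, starHom_nonneg φ h.2⟩ : {d : D // 0 ≤ d}) :=
    NonUnitalStarAlgHom.codRestrict (φ.comp (NonUnitalStarSubalgebraClass.subtype (hereditary h))) _
      fun x => by
        rw [← SetLike.mem_coe, ← himg]
        exact ⟨x.1, x.2, rfl⟩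
  refine ⟨StarAlgEquiv.ofBijective f ⟨fun x y hxy => ?_, fun y => ?_⟩⟩
  · exact Subtype.ext (hφ (congrArg Subtype.val hxy))
  · have hy : y.1 ∈ φ '' (hereditary h : Set C) := by rw [himg]; exact y.2
    obtain ⟨x, hx, hxy⟩ := hy
    exact ⟨⟨x, hx⟩, Subtype.ext hxy⟩

end Order

end Morphisms

end CStarFund

namespace CStarFund

/-! ### Countable additivity of lower semicontinuous traces -/

namespace Trace

variable {A : Type*} [NonUnitalCStarAlgebra A] [PartialOrder A] [StarOrderedRing A]

theorem congr (τ : Trace A) {a b : A} (ha : 0 ≤ a) (h : a = b) :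
    τ ⟨a, ha⟩ = τ ⟨b, h ▸ ha⟩ := by subst h; rfl

theorem mono (τ : Trace A) {a b : A} (ha : 0 ≤ a) (h : a ≤ b) :
    τ ⟨a, ha⟩ ≤ τ ⟨b, ha.trans h⟩ := by
  have h1 := τ.map_add ⟨a, ha⟩ ⟨b - a, sub_nonneg.mpr h⟩
  rw [τ.congr _ (add_sub_cancel a b)] at h1
  rw [h1]
  exact le_self_add

theorem map_sum_range (τ : Trace A) {f : ℕ → A} (hf : ∀ i, 0 ≤ f i) (n : ℕ) :
    τ ⟨∑ i ∈ Finset.range n, f i, Finset.sum_nonneg fun i _ => hf i⟩ =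
      ∑ i ∈ Finset.range n, τ ⟨f i, hf i⟩ := by
  induction n with
  | zero => exact τ.map_zero
  | succ n ih =>
    refine (τ.congr _ (Finset.sum_range_succ f n)).trans ?_
    rw [Finset.sum_range_succ (fun i => τ ⟨f i, hf i⟩), ← ih, ← τ.map_add]

/-- A lower semicontinuous trace is countably additive. -/
theorem eq_tsum (τ : Trace A) (hτ : LowerSemicontinuous τ) {f : ℕ → A} (hf : ∀ i, 0 ≤ f i)
    {a : A} (ha : 0 ≤ a)
    (h : Tendsto (fun n => ∑ i ∈ Finset.range n, f i) atTop (𝓝 a)) :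
    τ ⟨a, ha⟩ = ∑' i, τ ⟨f i, hf i⟩ := by
  have hs := hasSum_of_nonneg_of_tendsto_sum_range hf h
  apply le_antisymm
  · have ht : Tendsto (fun n => (⟨∑ i ∈ Finset.range n, f i,
        Finset.sum_nonneg fun i _ => hf i⟩ : {a : A // 0 ≤ a})) atTop (𝓝 ⟨a, ha⟩) :=
      tendsto_subtype_rng.mpr h
    refine le_of_forall_lt fun c hc => ?_
    obtain ⟨n, hn⟩ := (ht.eventually (hτ ⟨a, ha⟩ c hc)).exists
    rw [τ.map_sum_range hf] at hn
    exact hn.trans_le (ENNReal.sum_le_tsum _)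
  · rw [ENNReal.tsum_eq_iSup_nat]
    refine iSup_le fun n => ?_
    rw [← τ.map_sum_range hf]
    exact τ.mono _ (sum_le_hasSum _ (fun i _ => hf i) hs)

end Trace

end CStarFund

namespace CStarFund

/-! ### Compact operators on a Hilbert module -/

section Compacts

variable {R X : Type*} [NonUnitalCStarAlgebra R] [PartialOrder R] [StarOrderedRing R]
  [NormedAddCommGroup X] [NormedSpace ℂ X] [SMul R X] [CStarModule R X]

/-- `CStarModule` presupposes only `SMul R X`. The module laws for this action are forced by
nondegeneracy of the inner product. -/
theorem op_mul_smul (r s : R) (x : X) : (r * s) • x = r • s • x :=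
  ext_inner (R := R) fun z => by simp [mul_assoc]

theorem op_smul_add (r : R) (x y : X) : r • (x + y) = r • x + r • y :=
  ext_inner (R := R) fun z => by simp [mul_add]

theorem op_add_smul (r s : R) (x : X) : (r + s) • x = r • x + s • x :=
  ext_inner (R := R) fun z => by simp [add_mul]

theorem op_sub_smul (r s : R) (x : X) : (r - s) • x = r • x - s • x :=
  ext_inner (R := R) fun z => by simp [sub_mul]

theorem op_smul_zero (r : R) : r • (0 : X) = 0 :=
  ext_inner (R := R) fun z => by simp

theorem op_zero_smul (x : X) : (0 : R) • x = 0 :=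
  ext_inner (R := R) fun z => by simp

theorem op_smul_smul_comm (c : ℂ) (r : R) (x : X) : r • c • x = c • r • x :=
  ext_inner (R := R) fun z => by simp [mul_smul_comm]

theorem op_complex_smul_smul (c : ℂ) (r : R) (x : X) : (c • r) • x = c • r • x :=
  ext_inner (R := R) fun z => by simp [smul_mul_assoc]

variable (R X) in
/-- The action of `R` on a Hilbert `R`-module, as a continuous bilinear map. -/
noncomputable def opSMulCLM : R →L[ℂ] X →L[ℂ] X :=
  LinearMap.mkContinuous₂
    { toFun := fun r =>
        { toFun := fun x => r • x
          map_add' := op_smul_add r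
          map_smul' := fun c x => op_smul_smul_comm c r x }
      map_add' := fun r s => LinearMap.ext fun x => op_add_smul r s x
      map_smul' := fun c r => LinearMap.ext fun x => op_complex_smul_smul c r x }
    1 fun r x => by simpa using norm_op_smul_le r x

variable [CompleteSpace X]

namespace CompactOperators

/-- The bounded operator underlying a compact operator. -/
def act (T : CompactOperators R X) : X →L[ℂ] X := T.toAdjointable.toCLM

theorem act_mul (S T : CompactOperators R X) (x : X) : (S * T).act x = S.act (T.act x) := rfl
theorem act_add (S T : CompactOperators R X) (x : X) : (S + T).act x = S.act x + T.act x := rfl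
theorem act_smul (c : ℂ) (T : CompactOperators R X) (x : X) : (c • T).act x = c • T.act x := rfl
theorem act_zero (x : X) : (0 : CompactOperators R X).act x = 0 := rfl

theorem norm_eq_act (T : CompactOperators R X) : ‖T‖ = ‖T.act‖ := rfl

theorem ext_act {S T : CompactOperators R X} (h : ∀ x, S.act x = T.act x) : S = T :=
  Subtype.ext (Adjointable.toCLM_injective (ContinuousLinearMap.ext h))

theorem inner_act_left (T : CompactOperators R X) (x y : X) :
    inner R (T.act x) y = inner R x ((star T).act y) :=
  Adjointable.inner_left T.toAdjointable x y

theorem inner_act_right (T : CompactOperators R X) (x y : X) :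
    inner R x (T.act y) = inner R ((star T).act x) y :=
  Adjointable.inner_right T.toAdjointable x y

theorem act_op_smul (T : CompactOperators R X) (r : R) (x : X) : T.act (r • x) = r • T.act x :=
  ext_inner (R := R) fun z => by simp [inner_act_right]

theorem continuous_act (x : X) : Continuous fun T : CompactOperators R X => T.act x :=
  (ContinuousLinearMap.apply ℂ X x).continuous.comp
    (continuous_subtype_val.comp continuous_subtype_val)

/-- With `N = T⁻` one has `N T N = -N³`, so the hypothesis at `N x` gives `⟨x, N³ x⟩ ≤ 0`. As `N³ ≥
0`, this forces `N³ = 0` and `N = 0`. -/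
theorem nonneg_of_inner_nonneg {T : CompactOperators R X} (hT : IsSelfAdjoint T)
    (h : ∀ x, 0 ≤ (inner R x (T.act x) : R)) : 0 ≤ T := by
  rw [CStarAlgebra.nonneg_iff_isSelfAdjoint_and_negPart_eq_zero]
  refine ⟨hT, ?_⟩
  have hn : (0 : CompactOperators R X) ≤ T⁻ := CFC.negPart_nonneg T
  have hs : star T⁻ = T⁻ := (IsSelfAdjoint.of_nonneg hn).star_eq
  set N := T⁻ with hN
  have e1 : N * T * N = -(N * N * N) := by
    conv_lhs => rw [← CFC.posPart_sub_negPart T hT]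
    rw [mul_sub, CFC.negPart_mul_posPart, zero_sub, neg_mul]
  have h3 : 0 ≤ N * N * N := by
    have := star_left_conjugate_nonneg hn N
    rwa [hs] at this
  have h4 : ∀ x, (inner R x ((N * N * N).act x) : R) = 0 := fun x => by
    refine le_antisymm ?_ (inner_apply_nonneg h3 x)
    have h5 := h (N.act x)
    rw [← act_mul, inner_act_left, hs, ← act_mul, ← mul_assoc, e1] at h5
    have : (-(N * N * N)).act x = -((N * N * N).act x) := rfl
    rw [this, CStarModule.inner_neg_right] at h5
    exact neg_nonneg.mp h5
  obtain ⟨y, hy⟩ := CStarAlgebra.nonneg_iff_eq_star_mul_self.mp h3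
  have hy0 : y = 0 := ext_act fun x => by
    have := h4 x
    rw [hy, act_mul, ← inner_act_left] at this
    exact CStarModule.inner_self.mp this
  have h6 : N * N * N = 0 := by rw [hy, hy0, mul_zero]
  have h7 : N * N = 0 := by
    rw [← CStarRing.star_mul_self_eq_zero_iff, star_mul, hs, ← mul_assoc, h6, zero_mul]
  rw [← CStarRing.star_mul_self_eq_zero_iff, hs, h7]

end CompactOperators

open CompactOperators

variable (R) in
/-- The rank one operator `ζ ↦ ⟨η, ζ⟩ • ξ` as a compact operator. -/
noncomputable def theta (ξ η : X) : CompactOperators R X :=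
  ⟨rankOne R ξ η, subset_closure (Submodule.subset_span ⟨ξ, η, rfl⟩)⟩

theorem theta_act (ξ η ζ : X) : (theta R ξ η).act ζ = (inner R η ζ : R) • ξ := rfl

theorem star_theta (ξ η : X) : star (theta R ξ η) = theta R η ξ :=
  Subtype.ext (star_rankOne ξ η)

theorem mul_theta (T : CompactOperators R X) (ξ η : X) :
    T * theta R ξ η = theta R (T.act ξ) η :=
  ext_act fun x => by rw [act_mul, theta_act, theta_act, act_op_smul]

theorem theta_mul (T : CompactOperators R X) (ξ η : X) :
    theta R ξ η * T = theta R ξ ((star T).act η) :=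
  ext_act fun x => by rw [act_mul, theta_act, theta_act, inner_act_right]

theorem theta_op_smul (r : R) (ξ η : X) : theta R (r • ξ) η = theta R ξ (star r • η) :=
  ext_act fun x => by simp [theta_act, op_mul_smul]

theorem norm_theta_le (ξ η : X) : ‖theta R ξ η‖ ≤ ‖ξ‖ * ‖η‖ := by
  rw [norm_eq_act]
  refine ContinuousLinearMap.opNorm_le_bound _ (by positivity) fun ζ => ?_
  refine (norm_op_smul_le (R := R) _ ξ).trans ?_
  calc ‖(inner R η ζ : R)‖ * ‖ξ‖ ≤ (‖η‖ * ‖ζ‖) * ‖ξ‖ := by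
        gcongr; exact CStarModule.norm_inner_le X
    _ = _ := by ring

variable (R X) in
/-- `theta` as a continuous sesquilinear map, conjugate linear in the second variable. -/
noncomputable def thetaCLM : X →L[ℂ] X →L⋆[ℂ] CompactOperators R X :=
  LinearMap.mkContinuous₂
    (LinearMap.mk₂'ₛₗ (RingHom.id ℂ) (starRingEnd ℂ) (fun ξ η => theta R ξ η)
      (fun a b η => ext_act fun x => by simp [theta_act, act_add, op_smul_add])
      (fun c a η => ext_act fun x => by simp [theta_act, act_smul, op_smul_smul_comm])
      (fun a b η => ext_act fun x => by simp [theta_act, act_add, op_add_smul])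
      (fun c a η => ext_act fun x => by simp [theta_act, act_smul, op_complex_smul_smul]))
    1 fun ξ η => by
      rw [one_mul]
      exact norm_theta_le ξ η

theorem theta_self_nonneg (ξ : X) : 0 ≤ theta R ξ ξ := by
  refine nonneg_of_inner_nonneg (star_theta ξ ξ) fun x => ?_
  rw [theta_act, CStarModule.inner_op_smul_right, ← CStarModule.star_inner]
  exact star_mul_self_nonneg _

variable (R X) in
theorem dense_span_theta :
    Dense (Submodule.span ℂ {T : CompactOperators R X | ∃ ξ η, T = theta R ξ η} :
      Set (CompactOperators R X)) := by
  intro T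
  have h1 : T.toAdjointable ∈ closure (rankOneSpan R X : Set (Adjointable R X)) := T.2
  set M : Submodule ℂ (CompactOperators R X) := Submodule.span ℂ {T | ∃ ξ η, T = theta R ξ η}
    with hM
  have h2 : (rankOneSpan R X : Set (Adjointable R X)) ⊆ Subtype.val ''
      (M : Set (CompactOperators R X)) := by
    intro S hS
    induction hS using Submodule.span_induction with
    | mem x hx =>
      obtain ⟨ξ, η, rfl⟩ := hx
      have h3 : theta R ξ η ∈ M := Submodule.subset_span ⟨ξ, η, rfl⟩
      exact ⟨theta R ξ η, h3, rfl⟩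
    | zero => exact ⟨0, zero_mem M, rfl⟩
    | add a b _ _ ha hb =>
      obtain ⟨a, ha, rfl⟩ := ha
      obtain ⟨b, hb, rfl⟩ := hb
      exact ⟨a + b, M.add_mem ha hb, rfl⟩
    | smul c a _ ha =>
      obtain ⟨a, ha, rfl⟩ := ha
      exact ⟨c • a, M.smul_mem c ha, rfl⟩
  exact closure_subtype.mpr (closure_mono h2 h1)

end Compacts

/-! ### Polarization and the cone of rank one positives -/

section Polarization

variable {M N : Type*} [AddCommGroup M] [Module ℂ M] [AddCommGroup N] [Module ℂ N]

/-- Expanding at `x + y` gives `B x y + B y x`, and `I` times the expansion at `x + I y` gives `B x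
y - B y x`. Taking `S = ⊥` turns diagonal identities into full ones. -/
theorem polarization_mem (B : M →ₗ[ℂ] M →ₗ⋆[ℂ] N) (S : Submodule ℂ N) (h : ∀ x, B x x ∈ S)
    (x y : M) : B x y ∈ S := by
  have h1 := S.sub_mem (S.sub_mem (h (x + y)) (h x)) (h y)
  have h2 := S.smul_mem Complex.I
    (S.sub_mem (S.sub_mem (h (x + Complex.I • y)) (h x)) (h y))
  have h3 := S.smul_mem (2⁻¹ : ℂ) (S.add_mem h1 h2)
  convert h3 using 1
  simp only [map_add, LinearMap.add_apply, map_smul, LinearMap.smul_apply, map_smulₛₗ,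
    Complex.conj_I, smul_add, smul_sub, smul_smul]
  match_scalars <;> ring_nf <;> simp [Complex.I_sq, Complex.I_pow_three]
  all_goals ring_nf

end Polarization

section Cones

variable {R X : Type*} [NonUnitalCStarAlgebra R] [PartialOrder R] [StarOrderedRing R]
  [NormedAddCommGroup X] [NormedSpace ℂ X] [SMul R X] [CStarModule R X] [CompleteSpace X]

open CompactOperators

theorem real_smul_theta_self {r : ℝ} (hr : 0 ≤ r) (ξ : X) :
    r • theta R ξ ξ = theta R ((√r : ℂ) • ξ) ((√r : ℂ) • ξ) := by
  have h : (√r : ℂ) * √r = r := by rw [← Complex.ofReal_mul, Real.mul_self_sqrt hr]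
  refine ext_act fun x => ?_
  have h1 : (r • theta R ξ ξ).act x = (r : ℂ) • (theta R ξ ξ).act x := by
    rw [← act_smul, Complex.coe_smul]
  rw [h1, theta_act, theta_act, op_smul_smul_comm, CStarModule.inner_smul_left_complex,
    op_complex_smul_smul, smul_smul, ← h]
  simp

-- Conjugation invariance is `T θ_{ξ,ξ} T⋆ = θ_{Tξ,Tξ}`; density follows from that of all `θ_{ξ,η}`
-- by polarization.
variable (R X) in
theorem isConjCone_theta : IsConjCone {T : CompactOperators R X | ∃ ξ, T = theta R ξ ξ} where
  zero_mem := ⟨0, ext_act fun x => by rw [theta_act, op_smul_zero, act_zero]⟩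
  nonneg := by
    rintro _ ⟨ξ, rfl⟩
    exact theta_self_nonneg ξ
  conj := by
    rintro c _ ⟨ξ, rfl⟩
    exact ⟨c.act ξ, by rw [mul_theta, theta_mul, star_star]⟩
  smul := by
    rintro r hr _ ⟨ξ, rfl⟩
    exact ⟨_, real_smul_theta_self hr ξ⟩
  dense := by
    refine (dense_span_theta R X).mono (Submodule.span_le.mpr ?_)
    rintro _ ⟨ξ, η, rfl⟩
    let B : X →ₗ[ℂ] X →ₗ⋆[ℂ] CompactOperators R X :=
      LinearMap.mk₂'ₛₗ (RingHom.id ℂ) (starRingEnd ℂ) (fun ξ η => thetaCLM R X ξ η)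
        (by simp) (by simp) (by simp) (by simp)
    exact polarization_mem B (Submodule.span ℂ {T : CompactOperators R X | ∃ ξ, T = theta R ξ ξ})
      (fun ζ => Submodule.subset_span ⟨ζ, rfl⟩) ξ η

end Cones

end CStarFund

namespace CStarFund

open CompactOperators

/-! ### Isometries of Hilbert modules and their action on compact operators -/

section Isometry

variable {R X Y : Type*} [NonUnitalCStarAlgebra R] [PartialOrder R] [StarOrderedRing R]
  [NormedAddCommGroup X] [NormedSpace ℂ X] [SMul R X] [CStarModule R X]
  [NormedAddCommGroup Y] [NormedSpace ℂ Y] [SMul R Y] [CStarModule R Y]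

theorem inner_map_map_of_self (V : X →ₗ[ℂ] Y) (hV : ∀ x, (inner R (V x) (V x) : R) = inner R x x)
    (x y : X) : (inner R (V x) (V y) : R) = inner R x y := by
  let B : X →ₗ[ℂ] X →ₗ⋆[ℂ] R :=
    LinearMap.mk₂'ₛₗ (RingHom.id ℂ) (starRingEnd ℂ)
      (fun y x => inner R (V x) (V y) - inner R x y)
      (fun a b c => by simp; abel) (fun c a b => by simp [smul_sub])
      (fun a b c => by simp; abel) (fun c a b => by simp [smul_sub])
  have h := polarization_mem B ⊥ (fun x => by simp [B, hV]) y x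
  exact sub_eq_zero.mp ((Submodule.mem_bot ℂ).mp h)

/-- A linear map that preserves inner squares, as a linear isometry. -/
def isometryOfInner (V : X →ₗ[ℂ] Y) (hV : ∀ x, (inner R (V x) (V x) : R) = inner R x x) :
    X →ₗᵢ[ℂ] Y where
  toLinearMap := V
  norm_map' x := by
    rw [CStarModule.norm_eq_sqrt_norm_inner_self (A := R), hV,
      ← CStarModule.norm_eq_sqrt_norm_inner_self (A := R)]

theorem isometry_op_smul (V : X →ₗᵢ[ℂ] Y) (hV : ∀ x y, (inner R (V x) (V y) : R) = inner R x y)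
    (r : R) (x : X) : V (r • x) = r • V x := by
  rw [← sub_eq_zero, ← CStarModule.inner_self (A := R)]
  simp [hV, mul_assoc]

variable [CompleteSpace X] [CompleteSpace Y]

/-- A (not necessarily adjointable) isometry `V` of Hilbert modules induces the homomorphism
`T ↦ V T V⋆` of algebras of compact operators. -/
theorem exists_starHom_of_isometry (V : X →ₗᵢ[ℂ] Y)
    (hV : ∀ x y, (inner R (V x) (V y) : R) = inner R x y) :
    ∃ φ : CompactOperators R X →⋆ₙₐ[ℂ] CompactOperators R Y, Function.Injective φ ∧
      HasHereditaryRange φ ∧ ∀ ξ η, φ (theta R ξ η) = theta R (V ξ) (V η) := by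
  let M : Submodule ℂ Y := LinearMap.range V.toLinearMap
  have hM : IsClosed (M : Set Y) := by
    have : (M : Set Y) = Set.range V := by ext; simp [M]
    rw [this]
    exact V.isometry.isClosedEmbedding.isClosed_range
  have hVM : ∀ x, V x ∈ M := fun x => ⟨x, rfl⟩
  -- The graph of `T ↦ V T V⋆`, described without `V⋆`: the second entry and its adjoint intertwine
  -- `V` with the first entry and its adjoint, and both take values in the range `M` of `V`.
  let S : NonUnitalStarSubalgebra ℂ (CompactOperators R X × CompactOperators R Y) :=
    { carrier := {p | ((∀ x, p.2.act (V x) = V (p.1.act x)) ∧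
          ∀ x, (star p.2).act (V x) = V ((star p.1).act x)) ∧
          (∀ y, p.2.act y ∈ M) ∧ ∀ y, (star p.2).act y ∈ M}
      add_mem' := by
        rintro ⟨a, a'⟩ ⟨b, b'⟩ ⟨⟨h1, h2⟩, h3, h4⟩ ⟨⟨k1, k2⟩, k3, k4⟩
        refine ⟨⟨fun x => ?_, fun x => ?_⟩, fun y => ?_, fun y => ?_⟩
        · simp_all [act_add]
        · simp_all [act_add]
        · exact M.add_mem (h3 y) (k3 y)
        · simp only [Prod.mk_add_mk, star_add]
          exact M.add_mem (h4 y) (k4 y)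
      zero_mem' := by simp [act_zero]
      mul_mem' := by
        rintro ⟨a, a'⟩ ⟨b, b'⟩ ⟨⟨h1, h2⟩, h3, h4⟩ ⟨⟨k1, k2⟩, k3, k4⟩
        refine ⟨⟨fun x => ?_, fun x => ?_⟩, fun y => ?_, fun y => ?_⟩
        · simp_all [act_mul]
        · simp_all [act_mul]
        · exact h3 _
        · simp only [Prod.mk_mul_mk, star_mul]
          exact k4 _
      smul_mem' := by
        rintro c ⟨a, a'⟩ ⟨⟨h1, h2⟩, h3, h4⟩
        refine ⟨⟨fun x => ?_, fun x => ?_⟩, fun y => ?_, fun y => ?_⟩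
        · simp_all [act_smul]
        · simp_all [act_smul]
        · exact M.smul_mem c (h3 y)
        · simp only [Prod.smul_mk, star_smul]
          exact M.smul_mem _ (h4 y)
      star_mem' := by
        rintro ⟨a, a'⟩ ⟨⟨h1, h2⟩, h3, h4⟩
        refine ⟨⟨h2, fun x => ?_⟩, h4, fun y => ?_⟩
        · simpa using h1 x
        · simpa using h3 y }
  have hS : IsClosed (S : Set (CompactOperators R X × CompactOperators R Y)) := by
    have c1 : ∀ y, Continuous fun p : CompactOperators R X × CompactOperators R Y => p.2.act y :=
      fun y => (continuous_act y).comp continuous_snd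
    have c2 : ∀ y, Continuous fun p : CompactOperators R X × CompactOperators R Y =>
        (star p.2).act y := fun y => (continuous_act y).comp (continuous_star.comp continuous_snd)
    have c3 : ∀ x, Continuous fun p : CompactOperators R X × CompactOperators R Y =>
        V (p.1.act x) := fun y => V.continuous.comp ((continuous_act y).comp continuous_fst)
    have c4 : ∀ x, Continuous fun p : CompactOperators R X × CompactOperators R Y =>
        V ((star p.1).act x) := fun y =>
      V.continuous.comp ((continuous_act y).comp (continuous_star.comp continuous_fst))
    have hset : (S : Set (CompactOperators R X × CompactOperators R Y)) =
        ((⋂ x, {p | p.2.act (V x) = V (p.1.act x)}) ∩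
          ⋂ x, {p | (star p.2).act (V x) = V ((star p.1).act x)}) ∩
        ((⋂ y, {p | p.2.act y ∈ M}) ∩ ⋂ y, {p | (star p.2).act y ∈ M}) := by
      ext p
      simp only [Set.mem_inter_iff, Set.mem_iInter, Set.mem_ofPred_eq]
      rfl
    rw [hset]
    exact ((isClosed_iInter fun x => isClosed_eq (c1 _) (c3 x)).inter
      (isClosed_iInter fun x => isClosed_eq (c2 _) (c4 x))).inter
      ((isClosed_iInter fun y => hM.preimage (c1 y)).inter
        (isClosed_iInter fun y => hM.preimage (c2 y)))
  have hθ : ∀ ξ η, (theta R ξ η, theta R (V ξ) (V η)) ∈ S := fun ξ η => by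
    refine ⟨⟨fun x => ?_, fun x => ?_⟩, fun y => ?_, fun y => ?_⟩
    · simp only [theta_act, hV, isometry_op_smul V hV]
    · simp only [star_theta, theta_act, hV, isometry_op_smul V hV]
    · exact ⟨(inner R (V η) y : R) • ξ, isometry_op_smul V hV _ _⟩
    · exact ⟨(inner R (V ξ) y : R) • η, by
        simpa [star_theta, theta_act] using isometry_op_smul V hV _ _⟩
  obtain ⟨φ, hφ, hgraph⟩ := exists_starHom_of_graph S hS
    (fun T hT => ext_act fun x => V.injective (by
      have := hT.1.1 x
      simp only [act_zero] at this
      rw [← this, act_zero, map_zero]))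
    (fun T hT => by
      -- `T` vanishes on `M` and `T⋆` maps into `M`.
      have h0 : T * star T = 0 := ext_act fun y => by
        obtain ⟨x, hx⟩ := hT.2.2 y
        rw [act_mul, ← hx]
        have := hT.1.1 x
        simpa [act_zero] using this
      exact (CStarRing.mul_star_self_eq_zero_iff T).mp h0)
    (by
      let P : Submodule ℂ (CompactOperators R X) :=
        S.toNonUnitalSubalgebra.toSubmodule.map (LinearMap.fst ℂ _ _)
      refine (dense_span_theta R X).mono (?_ : _ ⊆ (P : Set (CompactOperators R X)))
      refine Submodule.span_le.mpr ?_
      rintro _ ⟨ξ, η, rfl⟩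
      exact ⟨_, hθ ξ η, rfl⟩)
  have hφθ : ∀ ξ η, φ (theta R ξ η) = theta R (V ξ) (V η) := fun ξ η =>
    (hgraph _ _).mp (hθ ξ η)
  refine ⟨φ, hφ, fun c c' d => ?_, hφθ⟩
  have hcl := range_isClosed_of_injective φ hφ
  let Q : Submodule ℂ (CompactOperators R Y) := LinearMap.range (LinearMapClass.linearMap φ)
  have hQ : (Q : Set (CompactOperators R Y)) = Set.range φ := by ext; simp [Q]
  have hφc := (NonUnitalStarAlgHom.isometry φ hφ).continuous
  -- On generators, `θ_{Vξ,Vη} d θ_{Vξ',Vη'} = θ_{Vξ'',Vη'}` with `ξ'' = ⟨Vη, d Vξ'⟩ • ξ`. Density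
  -- and closedness of the range of `φ` extend this to one factor, then to the other.
  have key : ∀ ξ η c' , φ (theta R ξ η) * d * φ c' ∈ Q := fun ξ η c' => by
    have hP : (Submodule.span ℂ {T : CompactOperators R X | ∃ ξ η, T = theta R ξ η}) ≤
        Q.comap (LinearMapClass.linearMap φ |> (LinearMap.mulLeft ℂ (φ (theta R ξ η) * d)).comp) := by
      refine Submodule.span_le.mpr ?_
      rintro _ ⟨ξ', η', rfl⟩
      change φ (theta R ξ η) * d * φ (theta R ξ' η') ∈ Q
      refine ⟨theta R ((inner R (V η) (d.act (V ξ')) : R) • ξ) η', ?_⟩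
      change φ _ = _
      rw [hφθ, hφθ, hφθ, mul_assoc, mul_theta, mul_theta, theta_act, isometry_op_smul V hV]
    have h1 : IsClosed {c' | φ (theta R ξ η) * d * φ c' ∈ Q} := by
      change IsClosed ((fun c' => φ (theta R ξ η) * d * φ c') ⁻¹' (Q : Set (CompactOperators R Y)))
      rw [hQ]
      exact hcl.preimage (continuous_const.mul hφc)
    exact closure_minimal (fun x hx => hP hx) h1 (dense_span_theta R X c')
  have hP : (Submodule.span ℂ {T : CompactOperators R X | ∃ ξ η, T = theta R ξ η}) ≤
      Q.comap (LinearMapClass.linearMap φ |> (LinearMap.mulRight ℂ (d * φ c')).comp) := by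
    refine Submodule.span_le.mpr ?_
    rintro _ ⟨ξ', η', rfl⟩
    have := key ξ' η' c'
    rwa [mul_assoc] at this
  have h1 : IsClosed {c | φ c * (d * φ c') ∈ Q} := by
    change IsClosed ((fun c => φ c * (d * φ c')) ⁻¹' (Q : Set (CompactOperators R Y)))
    rw [hQ]
    exact hcl.preimage (hφc.mul continuous_const)
  have h2 : φ c * (d * φ c') ∈ Q :=
    closure_minimal (fun x hx => hP hx) h1 (dense_span_theta R X c)
  rw [← SetLike.mem_coe, hQ] at h2
  rwa [mul_assoc]

end Isometry

/-! ### Parseval frames and induced traces -/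

section Parseval

variable {R X : Type*} [NonUnitalCStarAlgebra R] [PartialOrder R] [StarOrderedRing R]
  [NormedAddCommGroup X] [NormedSpace ℂ X] [SMul R X] [CStarModule R X]

variable (R) in
/-- A family `ξ` is a Parseval frame if `∑ ⟨η, ξᵢ⟩ ⟨ξᵢ, η⟩ = ⟨η, η⟩` for all `η`. -/
def IsParseval {ι : Type*} (ξ : ι → X) : Prop :=
  ∀ η, HasSum (fun i => (inner R (ξ i) η * inner R η (ξ i) : R)) (inner R η η)

theorem HilbertSum.tendsto_trunc (x : HilbertSum R X) :
    Tendsto (fun n => HilbertSum.trunc (Finset.range n) x) atTop (𝓝 x) := by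
  have h0 : ∀ s : Finset ℕ, (inner R (x - HilbertSum.trunc s x) (x - HilbertSum.trunc s x) : R) =
      inner R x x - ∑ i ∈ s, inner R (x i) (x i) := fun s => by
    have e1 : (inner R x (HilbertSum.trunc s x : HilbertSum R X) : R) =
        ∑ i ∈ s, inner R (x i) (x i) := by
      rw [HilbertSum.inner_def, tsum_eq_sum (s := s) fun n hn => by simp [HilbertSum.trunc_apply, hn]]
      exact Finset.sum_congr rfl fun n hn => by simp [HilbertSum.trunc_apply, hn]
    have e2 : (inner R (HilbertSum.trunc s x : HilbertSum R X) x : R) =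
        ∑ i ∈ s, inner R (x i) (x i) := by
      rw [HilbertSum.inner_def, tsum_eq_sum (s := s) fun n hn => by simp [HilbertSum.trunc_apply, hn]]
      exact Finset.sum_congr rfl fun n hn => by simp [HilbertSum.trunc_apply, hn]
    have e3 : (inner R (HilbertSum.trunc s x : HilbertSum R X) (HilbertSum.trunc s x) : R) =
        ∑ i ∈ s, inner R (x i) (x i) := by
      rw [HilbertSum.inner_def, tsum_eq_sum (s := s) fun n hn => by simp [HilbertSum.trunc_apply, hn]]
      exact Finset.sum_congr rfl fun n hn => by simp [HilbertSum.trunc_apply, hn]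
    rw [CStarModule.inner_sub_left (A := R) (E := HilbertSum R X),
      CStarModule.inner_sub_right (A := R) (E := HilbertSum R X),
      CStarModule.inner_sub_right (A := R) (E := HilbertSum R X), e1, e2, e3]
    abel
  rw [tendsto_iff_norm_sub_tendsto_zero]
  have h1 : Tendsto (fun n => inner R x x - ∑ i ∈ Finset.range n, (inner R (x i) (x i) : R)) atTop
      (𝓝 0) := by
    have h3 := x.summable_self.hasSum.tendsto_sum_nat.const_sub (inner R x x : R)
    rwa [← HilbertSum.inner_def, sub_self] at h3
  have h2 := (h1.norm.sqrt)
  simp only [norm_zero, Real.sqrt_zero] at h2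
  refine h2.congr fun n => ?_
  rw [norm_sub_rev (HilbertSum.trunc _ _ : HilbertSum R X) x,
    CStarModule.norm_eq_sqrt_norm_inner_self (A := R) (E := HilbertSum R X), h0]

end Parseval

section Frames

open MulOpposite

variable {A X : Type*} [NonUnitalCStarAlgebra A] [PartialOrder A] [StarOrderedRing A]
  [NormedAddCommGroup X] [NormedSpace ℂ X] [SMul Aᵐᵒᵖ X] [CStarModule Aᵐᵒᵖ X]

/-- A Parseval frame embeds a right Hilbert `A`-module isometrically into `H_A`. -/
theorem IsParseval.exists_isometry {ξ : ℕ → X} (hξ : IsParseval Aᵐᵒᵖ ξ) :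
    ∃ V : X →ₗᵢ[ℂ] StandardModule A,
      (∀ x y, (inner Aᵐᵒᵖ (V x) (V y) : Aᵐᵒᵖ) = inner Aᵐᵒᵖ x y) ∧
      ∀ x i, V x i = unop (inner Aᵐᵒᵖ (ξ i) x) := by
  have h0 : ∀ x i, (inner Aᵐᵒᵖ (unop (inner Aᵐᵒᵖ (ξ i) x)) (unop (inner Aᵐᵒᵖ (ξ i) x)) : Aᵐᵒᵖ) =
      inner Aᵐᵒᵖ (ξ i) x * inner Aᵐᵒᵖ x (ξ i) := fun x i => by
    change op (star (unop (inner Aᵐᵒᵖ (ξ i) x)) * unop (inner Aᵐᵒᵖ (ξ i) x)) = _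
    rw [← unop_star, CStarModule.star_inner, ← unop_mul, op_unop]
  let V₀ : X →ₗ[ℂ] StandardModule A :=
    { toFun := fun x => HilbertSum.mk (fun i => unop (inner Aᵐᵒᵖ (ξ i) x)) (by
        simp only [h0]
        exact (hξ x).summable)
      map_add' := fun x y => HilbertSum.ext fun i => by simp
      map_smul' := fun c x => HilbertSum.ext fun i => by simp }
  have hV₀ : ∀ x, (inner Aᵐᵒᵖ (V₀ x) (V₀ x) : Aᵐᵒᵖ) = inner Aᵐᵒᵖ x x := fun x => by
    rw [HilbertSum.inner_def]
    refine HasSum.tsum_eq ?_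
    exact (hξ x).congr_fun (h0 x)
  exact ⟨isometryOfInner V₀ hV₀, inner_map_map_of_self V₀ hV₀, fun x i => rfl⟩

/-- The error `D` of the frame expansion satisfies `⟨ζ, D⟩ = ⟨Vζ, tail of Vη⟩` for the embedding `V`
into `H_A`. Cauchy–Schwarz at `ζ = D` bounds `‖D‖` by the norm of the tail. -/
theorem IsParseval.isCountableBasis {ξ : ℕ → X} (hξ : IsParseval Aᵐᵒᵖ ξ) :
    IsCountableBasis A ξ := by
  obtain ⟨V, hV, hVi⟩ := hξ.exists_isometry
  intro η
  have h1 := (HilbertSum.tendsto_trunc (V η)).const_sub (V η)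
  rw [sub_self, tendsto_zero_iff_norm_tendsto_zero] at h1
  rw [tendsto_iff_norm_sub_tendsto_zero]
  refine squeeze_zero (fun n => norm_nonneg _) (fun n => ?_) h1
  rw [norm_sub_rev]
  set D := η - ∑ i ∈ Finset.range n, (inner Aᵐᵒᵖ (ξ i) η : Aᵐᵒᵖ) • ξ i with hD
  have h2 : ∀ ζ, (inner Aᵐᵒᵖ ζ D : Aᵐᵒᵖ) =
      inner Aᵐᵒᵖ (V ζ) (V η - HilbertSum.trunc (Finset.range n) (V η)) := fun ζ => by
    rw [hD, CStarModule.inner_sub_right,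
      CStarModule.inner_sub_right (A := Aᵐᵒᵖ) (E := StandardModule A), hV,
      CStarModule.inner_sum_right]
    congr 1
    rw [HilbertSum.inner_def, tsum_eq_sum (s := Finset.range n) fun i hi => by
      simp [HilbertSum.trunc_apply, Finset.mem_range.not.mp hi]]
    refine Finset.sum_congr rfl fun i hi => ?_
    rw [HilbertSum.trunc_apply, if_pos hi, hVi, hVi, CStarModule.inner_op_smul_right]
    change _ = op (star (unop (inner Aᵐᵒᵖ (ξ i) ζ)) * unop (inner Aᵐᵒᵖ (ξ i) η))
    rw [← unop_star, CStarModule.star_inner, ← unop_mul, op_unop]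
  have h3 : ‖D‖ * ‖D‖ ≤ ‖D‖ * ‖V η - HilbertSum.trunc (Finset.range n) (V η)‖ := by
    calc ‖D‖ * ‖D‖ = ‖(inner Aᵐᵒᵖ D D : Aᵐᵒᵖ)‖ := by
          rw [← CStarModule.norm_sq_eq Aᵐᵒᵖ, sq]
      _ ≤ ‖V D‖ * ‖V η - HilbertSum.trunc (Finset.range n) (V η)‖ := by
          rw [h2]; exact CStarModule.norm_inner_le _
      _ = _ := by rw [V.norm_map]
  by_cases h4 : ‖D‖ = 0
  · rw [h4]; exact norm_nonneg _
  · exact le_of_mul_le_mul_left h3 (lt_of_le_of_ne (norm_nonneg _) (Ne.symm h4))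

variable [CompleteSpace X]

/-- With `bᵢⱼ = ⟨ζⱼ, ξᵢ⟩` the two sides are the double sums of `τ(bᵢⱼ⋆ bᵢⱼ)` and of `τ(bᵢⱼ bᵢⱼ⋆)`.
The right side does not involve `ξ`, whence independence of the basis. -/
theorem tsum_basis_eq (τ : Trace A) (hτ : LowerSemicontinuous τ) {ξ : ℕ → X}
    (hξ : IsCountableBasis A ξ) (x : {x : CompactOperators Aᵐᵒᵖ X // 0 ≤ x}) {ζ : ℕ → X}
    (hζ : HasSum (fun j => theta Aᵐᵒᵖ (ζ j) (ζ j)) x.1) :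
    ∑' i, τ ⟨unop (inner Aᵐᵒᵖ (ξ i) (x.1.toAdjointable.toCLM (ξ i))),
      unop_nonneg.mpr (CompactOperators.inner_apply_nonneg x.2 (ξ i))⟩ =
    ∑' j, τ ⟨unop (inner Aᵐᵒᵖ (ζ j) (ζ j)), unop_nonneg.mpr CStarModule.inner_self_nonneg⟩ := by
  set b : ℕ → ℕ → A := fun i j => unop (inner Aᵐᵒᵖ (ζ j) (ξ i)) with hb
  have hbs : ∀ i j, star (b i j) = unop (inner Aᵐᵒᵖ (ξ i) (ζ j)) := fun i j => by
    rw [hb, ← unop_star, CStarModule.star_inner]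
  have h1 : ∀ i, τ ⟨unop (inner Aᵐᵒᵖ (ξ i) (x.1.toAdjointable.toCLM (ξ i))),
      unop_nonneg.mpr (CompactOperators.inner_apply_nonneg x.2 (ξ i))⟩ =
      ∑' j, τ ⟨star (b i j) * b i j, star_mul_self_nonneg _⟩ := fun i => by
    refine τ.eq_tsum hτ (fun j => star_mul_self_nonneg (b i j)) _ ?_
    have hc : Continuous fun T : CompactOperators Aᵐᵒᵖ X =>
        unop (inner Aᵐᵒᵖ (ξ i) (T.act (ξ i)) : Aᵐᵒᵖ) :=
      continuous_unop.comp (CStarModule.continuous_inner.comp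
        (continuous_const.prodMk (continuous_act (ξ i))))
    refine ((hc.tendsto _).comp hζ.tendsto_sum_nat).congr fun n => ?_
    induction n with
    | zero => simp [act_zero]
    | succ n ih =>
      rw [Finset.sum_range_succ, ← ih]
      simp only [Function.comp_apply]
      rw [Finset.sum_range_succ, act_add, CStarModule.inner_add_right, unop_add, theta_act,
        CStarModule.inner_op_smul_right, hbs, unop_mul]
  have h2 : ∀ j, τ ⟨unop (inner Aᵐᵒᵖ (ζ j) (ζ j)), unop_nonneg.mpr CStarModule.inner_self_nonneg⟩ =
      ∑' i, τ ⟨b i j * star (b i j), mul_star_self_nonneg _⟩ := fun j => by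
    refine τ.eq_tsum hτ (fun i => mul_star_self_nonneg (b i j)) _ ?_
    have hc : Continuous fun y : X => unop (inner Aᵐᵒᵖ (ζ j) y : Aᵐᵒᵖ) :=
      continuous_unop.comp (CStarModule.continuous_inner.comp
        (continuous_const.prodMk continuous_id))
    refine ((hc.tendsto _).comp (hξ (ζ j))).congr fun n => ?_
    simp only [Function.comp_apply, CStarModule.inner_sum_right, CStarModule.inner_op_smul_right]
    rw [Finset.unop_sum]
    exact Finset.sum_congr rfl fun i _ => by rw [hbs, unop_mul]
  simp only [h1, h2, τ.map_star_mul_self]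
  exact ENNReal.tsum_comm

/-- All bases give the same value; the basis `ξ` ensures that the infimum is not over an empty
family. -/
theorem inducedTrace_eq (τ : Trace A) (hτ : LowerSemicontinuous τ) {ξ : ℕ → X}
    (hξ : IsCountableBasis A ξ) (x : {x : CompactOperators Aᵐᵒᵖ X // 0 ≤ x}) {ζ : ℕ → X}
    (hζ : HasSum (fun j => theta Aᵐᵒᵖ (ζ j) (ζ j)) x.1) :
    inducedTrace τ x =
      ∑' j, τ ⟨unop (inner Aᵐᵒᵖ (ζ j) (ζ j)), unop_nonneg.mpr CStarModule.inner_self_nonneg⟩ :=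
  le_antisymm (iInf₂_le_of_le ξ hξ (tsum_basis_eq τ hτ hξ x hζ).le)
    (le_iInf₂ fun _ h => (tsum_basis_eq τ hτ h x hζ).ge)

end Frames

end CStarFund

namespace CStarFund

open CompactOperators

/-! ### Approximate units, full modules and infinite direct sums -/

section HilbertModules

variable {R X : Type*} [NonUnitalCStarAlgebra R] [PartialOrder R] [StarOrderedRing R]
  [NormedAddCommGroup X] [NormedSpace ℂ X] [SMul R X] [CStarModule R X]

/-- For `y = ⟨x, x⟩^{1/2}` one has `‖u x - x‖ = ‖u y - y‖`, which reduces the claim to `R` itself.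
-/
theorem tendsto_op_smul {l : Filter R} (hl : l.IsApproximateUnit) (x : X) :
    Tendsto (fun u : R => u • x) l (𝓝 x) := by
  set y : R := CFC.sqrt (inner R x x) with hy
  have hyy : y * y = inner R x x := CFC.sqrt_mul_sqrt_self _ CStarModule.inner_self_nonneg
  have hys : star y = y := (IsSelfAdjoint.of_nonneg (CFC.sqrt_nonneg _)).star_eq
  have h1 : ∀ u : R, ‖u • x - x‖ = ‖u * y - y‖ := fun u => by
    rw [CStarModule.norm_eq_sqrt_norm_inner_self (A := R)]
    have h2 : (inner R (u • x - x) (u • x - x) : R) = (u * y - y) * star (u * y - y) := by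
      simp only [CStarModule.inner_sub_left, CStarModule.inner_sub_right,
        CStarModule.inner_op_smul_left, CStarModule.inner_op_smul_right, ← hyy, star_sub, star_mul,
        hys]
      noncomm_ring
    rw [h2, CStarRing.norm_self_mul_star, Real.sqrt_mul_self (norm_nonneg _)]
  rw [tendsto_iff_norm_sub_tendsto_zero]
  simp only [h1]
  rw [← tendsto_iff_norm_sub_tendsto_zero]
  exact hl.tendsto_mul_right y

/-- Fullness gives density of all inner products, and polarization reduces these to the diagonal
ones. -/
theorem isConjCone_inner_self
    (hfull : Dense (Submodule.span ℂ {r : R | ∃ ξ η : X, r = inner R η ξ} : Set R)) :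
    IsConjCone {r : R | ∃ ξ : X, r = inner R ξ ξ} where
  zero_mem := ⟨0, by simp⟩
  nonneg := by
    rintro _ ⟨ξ, rfl⟩
    exact CStarModule.inner_self_nonneg
  conj := by
    rintro c _ ⟨ξ, rfl⟩
    exact ⟨c • ξ, by simp [mul_assoc]⟩
  smul := by
    rintro r hr _ ⟨ξ, rfl⟩
    have h : (√r : ℂ) * √r = r := by rw [← Complex.ofReal_mul, Real.mul_self_sqrt hr]
    refine ⟨(√r : ℂ) • ξ, ?_⟩
    rw [CStarModule.inner_smul_left_complex, CStarModule.inner_smul_right_complex, smul_smul,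
      Complex.star_def, Complex.conj_ofReal, h, Complex.coe_smul]
  dense := by
    refine hfull.mono (Submodule.span_le.mpr ?_)
    rintro _ ⟨ξ, η, rfl⟩
    let B : X →ₗ[ℂ] X →ₗ⋆[ℂ] R :=
      LinearMap.mk₂'ₛₗ (RingHom.id ℂ) (starRingEnd ℂ) (fun ξ η => inner R η ξ)
        (by simp) (by simp) (by simp) (by simp)
    exact polarization_mem B (Submodule.span ℂ {r : R | ∃ ξ : X, r = inner R ξ ξ})
      (fun ζ => Submodule.subset_span ⟨ζ, rfl⟩) ξ η

/-- The series `∑ p` converges only strictly. A positive map `f` that converges along every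
approximate unit nevertheless turns it into a norm convergent series. -/
theorem hasSum_of_strict_unit {C : Type*} [NonUnitalCStarAlgebra C] [PartialOrder C]
    [StarOrderedRing C] {p : ℕ × ℕ → C} {d : ℕ → C} (hp : ∀ i, 0 ≤ p i) (hd : ∀ n, 0 ≤ d n)
    (hpd : ∀ n, HasSum (fun j => p (n, j)) (d n))
    (hu : (map (fun n => ∑ i ∈ Finset.range n, d i) atTop).IsApproximateUnit)
    (f : C →L[ℂ] R) (hf : ∀ c, 0 ≤ c → 0 ≤ f c) {x : R}
    (hx : ∀ l : Filter C, l.IsApproximateUnit → Tendsto f l (𝓝 x)) :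
    HasSum (fun i => f (p i)) x := by
  refine hasSum_prod_of_nonneg (fun i => hf _ (hp i)) (fun n => f.hasSum (hpd n)) ?_
  refine hasSum_of_nonneg_of_tendsto_sum_range (fun n => hf _ (hd n)) ?_
  have h := tendsto_map'_iff.mp (hx _ hu)
  refine h.congr fun n => ?_
  simp

/-- A full Hilbert module over a `σ`-unital C⋆-algebra `R` contains a sequence `g` with
`∑ ⟨gᵢ, gᵢ⟩ = 1` strictly. -/
theorem exists_hasSum_inner_self
    (hfull : Dense (Submodule.span ℂ {r : R | ∃ ξ η : X, r = inner R η ξ} : Set R))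
    (hσ : IsSigmaUnital R) :
    ∃ g : ℕ → X, ∀ r : R, HasSum (fun i => r * inner R (g i) (g i) * star r) (r * star r) := by
  obtain ⟨p, d, hpP, hd, hpd, hu⟩ := (isConjCone_inner_self hfull).exists_strict_unit hσ
  choose g hg using hpP
  refine ⟨fun n => g (Nat.pairEquiv.symm n), fun r => ?_⟩
  let f : R →L[ℂ] R := (ContinuousLinearMap.mul ℂ R).flip (star r) ∘L ContinuousLinearMap.mul ℂ R r
  have h := hasSum_of_strict_unit (fun i => by rw [hg]; exact CStarModule.inner_self_nonneg) hd
    hpd hu f (fun c hc => star_right_conjugate_nonneg hc r) (x := r * star r) fun l hl =>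
      (hl.tendsto_mul_left r).mul_const (star r)
  refine (Equiv.hasSum_iff Nat.pairEquiv.symm
    (f := fun i => r * inner R (g i) (g i) * star r)).mpr (h.congr_fun fun i => ?_)
  rw [← hg]
  rfl

/-- The inclusion of `X` as the `n`-th summand of `X ⊕ X ⊕ ⋯`. -/
noncomputable def HilbertSum.single (n : ℕ) (x : X) : HilbertSum R X :=
  HilbertSum.trunc {n} fun _ => x

theorem HilbertSum.single_apply (n : ℕ) (x : X) (m : ℕ) :
    (HilbertSum.single n x : HilbertSum R X) m = if m = n then x else 0 := by
  simp [single, trunc_apply]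

theorem HilbertSum.inner_single_left (n : ℕ) (x : X) (y : HilbertSum R X) :
    (inner R (HilbertSum.single n x : HilbertSum R X) y : R) = inner R x (y n) := by
  rw [inner_def, tsum_eq_single n fun m hm => by simp [single_apply, hm]]
  simp [single_apply]

theorem HilbertSum.inner_single_right (n : ℕ) (x : X) (y : HilbertSum R X) :
    (inner R y (HilbertSum.single n x : HilbertSum R X) : R) = inner R (y n) x := by
  rw [inner_def, tsum_eq_single n fun m hm => by simp [single_apply, hm]]
  simp [single_apply]

variable (R X) in
/-- `HilbertSum.single` as a linear map. -/
noncomputable def HilbertSum.singleₗ (n : ℕ) : X →ₗ[ℂ] HilbertSum R X where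
  toFun := HilbertSum.single n
  map_add' x y := HilbertSum.ext fun m => by
    simp only [single_apply, add_apply]; split_ifs <;> simp
  map_smul' c x := HilbertSum.ext fun m => by
    simp only [single_apply, smul_apply, RingHom.id_apply]; split_ifs <;> simp

theorem HilbertSum.continuous_single (n : ℕ) :
    Continuous (HilbertSum.single n : X → HilbertSum R X) :=
  (isometryOfInner (R := R) (HilbertSum.singleₗ R X n) fun x => by
    change (inner R (HilbertSum.single n x : HilbertSum R X) (HilbertSum.single n x) : R) = _
    rw [inner_single_left, single_apply, if_pos rfl]).continuous

theorem HilbertSum.trunc_range_eq_sum (x : HilbertSum R X) (n : ℕ) :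
    (HilbertSum.trunc (Finset.range n) x : HilbertSum R X) = ∑ i ∈ Finset.range n, HilbertSum.single i (x i) := by
  induction n with
  | zero => ext m; simp [trunc_apply]
  | succ n ih =>
    rw [Finset.sum_range_succ, ← ih]
    ext m
    simp only [trunc_apply, add_apply, single_apply, Finset.mem_range]
    rcases lt_trichotomy m n with h | h | h
    · rw [if_pos (by omega), if_pos h, if_neg (by omega), add_zero]
    · subst h; simp
    · rw [if_neg (by omega), if_neg (by omega), if_neg (by omega), add_zero]

/-- A Parseval frame for `X` yields one for `X ⊕ X ⊕ ⋯`. -/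
theorem IsParseval.hilbertSum {ξ : ℕ → X} (hξ : IsParseval R ξ) :
    IsParseval R fun n => (HilbertSum.single (Nat.pairEquiv.symm n).1
      (ξ (Nat.pairEquiv.symm n).2) : HilbertSum R X) := fun η => by
  refine (Equiv.hasSum_iff Nat.pairEquiv.symm (f := fun i : ℕ × ℕ =>
    (inner R (HilbertSum.single i.1 (ξ i.2) : HilbertSum R X) η *
      inner R η (HilbertSum.single i.1 (ξ i.2) : HilbertSum R X) : R))).mpr ?_
  simp only [HilbertSum.inner_single_left, HilbertSum.inner_single_right]
  refine hasSum_prod_of_nonneg (fun i => ?_) (fun n => hξ (η n)) η.summable_self.hasSum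
  rw [← CStarModule.star_inner (η i.1)]
  exact star_mul_self_nonneg _

end HilbertModules

/-! ### Equivalence bimodules: faithfulness, frames and embeddings -/

section Bimodule

open MulOpposite

theorem IsSigmaUnital.op {A : Type*} [NonUnitalCStarAlgebra A] [PartialOrder A]
    [StarOrderedRing A] (h : IsSigmaUnital A) : IsSigmaUnital Aᵐᵒᵖ := by
  obtain ⟨u, hu, hua⟩ := h
  have hne := hua.neBot
  refine ⟨fun n => MulOpposite.op (u n), fun m n h => MulOpposite.op_le_op.mpr (hu h), ?_⟩
  have e : map (fun n => MulOpposite.op (u n)) atTop = map MulOpposite.op (map u atTop) := by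
    rw [map_map]; rfl
  rw [e]
  refine ⟨⟨fun m => ?_, fun m => ?_⟩, ?_, ?_⟩
  · exact tendsto_map'_iff.mpr
      ((continuous_op.tendsto _).comp (hua.tendsto_mul_right (MulOpposite.unop m)))
  · exact tendsto_map'_iff.mpr
      ((continuous_op.tendsto _).comp (hua.tendsto_mul_left (MulOpposite.unop m)))
  · exact eventually_map.mpr (hua.eventually_nonneg.mono fun x hx => op_nonneg.mpr hx)
  · exact eventually_map.mpr hua.eventually_norm

/-- By density `c` also annihilates `c⋆`, so `c c⋆ = 0`. -/
theorem eq_zero_of_dense_mul {C : Type*} [NonUnitalCStarAlgebra C] {P : Set C}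
    (hP : Dense (Submodule.span ℂ P : Set C)) {c : C} (h : ∀ p ∈ P, c * p = 0) : c = 0 := by
  let M : Submodule ℂ C := LinearMap.ker (LinearMap.mulLeft ℂ c)
  have h1 : IsClosed (M : Set C) := by
    change IsClosed ((fun x => c * x) ⁻¹' {0})
    exact isClosed_singleton.preimage (continuous_const.mul continuous_id)
  have h2 : star c ∈ M :=
    closure_minimal (Submodule.span_le.mpr fun p hp => h p hp : Submodule.span ℂ P ≤ M) h1
      (hP (star c))
  exact (CStarRing.mul_star_self_eq_zero_iff c).mp h2

variable {A B F : Type*}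
    [NonUnitalCStarAlgebra A] [PartialOrder A] [StarOrderedRing A]
    [NonUnitalCStarAlgebra B] [PartialOrder B] [StarOrderedRing B]
    [NormedAddCommGroup F] [NormedSpace ℂ F] [CompleteSpace F] [SMul A F] [SMul Bᵐᵒᵖ F]
    [CStarModule A F] [CStarModule Bᵐᵒᵖ F]

namespace IsEquivalenceBimodule

theorem dense_op (h : IsEquivalenceBimodule A B F) :
    Dense (Submodule.span ℂ {b : Bᵐᵒᵖ | ∃ ξ η : F, b = inner Bᵐᵒᵖ η ξ} : Set Bᵐᵒᵖ) := by
  have h1 := (opHomeomorph (M := B)).surjective.denseRange.dense_image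
    (opHomeomorph (M := B)).continuous h.full_right
  refine h1.mono ?_
  rintro _ ⟨b, hb, rfl⟩
  let e : B ≃ₗ[ℂ] Bᵐᵒᵖ := opLinearEquiv ℂ
  have h2 : Submodule.span ℂ {b : B | ∃ ξ η : F, b = unop (inner Bᵐᵒᵖ ξ η)} ≤
      (Submodule.span ℂ {b : Bᵐᵒᵖ | ∃ ξ η : F, b = inner Bᵐᵒᵖ η ξ}).comap
        (e : B →ₗ[ℂ] Bᵐᵒᵖ) := by
    refine Submodule.span_le.mpr ?_
    rintro _ ⟨ξ, η, rfl⟩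
    exact Submodule.subset_span ⟨η, ξ, rfl⟩
  exact h2 hb

theorem right_faithful (h : IsEquivalenceBimodule A B F) {b : Bᵐᵒᵖ} (hb : ∀ ζ : F, b • ζ = 0) :
    b = 0 :=
  eq_zero_of_dense_mul h.dense_op (by
    rintro _ ⟨ξ, η, rfl⟩
    rw [← CStarModule.inner_op_smul_right, hb, CStarModule.inner_zero_right])

theorem left_faithful (h : IsEquivalenceBimodule A B F) {a : A} (ha : ∀ ζ : F, a • ζ = 0) :
    a = 0 :=
  eq_zero_of_dense_mul h.full_left (by
    rintro _ ⟨ξ, η, rfl⟩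
    rw [← CStarModule.inner_op_smul_right, ha, CStarModule.inner_zero_right])

/-- Adjointability of the left action is not among the axioms. Both sides act equally on `F`, by the
compatibility of the inner products, and the right action is faithful. -/
theorem inner_smul_left (h : IsEquivalenceBimodule A B F) (a : A) (ξ η : F) :
    (inner Bᵐᵒᵖ (a • ξ) η : Bᵐᵒᵖ) = inner Bᵐᵒᵖ ξ (star a • η) := by
  rw [← sub_eq_zero]
  refine h.right_faithful fun ζ => ?_
  rw [op_sub_smul, sub_eq_zero, ← h.inner_smul, ← h.inner_smul, CStarModule.inner_op_smul_left,
    op_mul_smul]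

theorem inner_smul_self (h : IsEquivalenceBimodule A B F) (ξ η : F) :
    (inner Bᵐᵒᵖ η ((inner A ξ ξ : A) • η) : Bᵐᵒᵖ) = inner Bᵐᵒᵖ ξ η * inner Bᵐᵒᵖ η ξ := by
  rw [h.inner_smul, CStarModule.inner_op_smul_right]

theorem inner_smul_nonneg (h : IsEquivalenceBimodule A B F) {a : A} (ha : 0 ≤ a) (η : F) :
    0 ≤ (inner Bᵐᵒᵖ η (a • η) : Bᵐᵒᵖ) := by
  obtain ⟨y, rfl⟩ := CStarAlgebra.nonneg_iff_eq_star_mul_self.mp ha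
  rw [op_mul_smul, ← h.inner_smul_left]
  exact CStarModule.inner_self_nonneg

/-- The map `a ↦ ⟨ξ, a η⟩_B`. -/
noncomputable def matrixCoeff (A B : Type*) {F : Type*}
    [NonUnitalCStarAlgebra A] [PartialOrder A] [StarOrderedRing A]
    [NonUnitalCStarAlgebra B] [PartialOrder B] [StarOrderedRing B]
    [NormedAddCommGroup F] [NormedSpace ℂ F] [SMul A F] [SMul Bᵐᵒᵖ F]
    [CStarModule A F] [CStarModule Bᵐᵒᵖ F] (ξ η : F) : A →L[ℂ] Bᵐᵒᵖ :=
  (CStarModule.innerSL (A := Bᵐᵒᵖ) ξ) ∘L (opSMulCLM A F).flip η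

theorem matrixCoeff_apply (ξ η : F) (a : A) :
    matrixCoeff A B ξ η a = inner Bᵐᵒᵖ ξ (a • η) := rfl

/-- Fullness on the left yields `∑ _A⟨gᵢ, gᵢ⟩ = 1` strictly. Inserting this in `⟨η, η⟩_B` and using
`_A⟨g, g⟩ η = g ⟨g, η⟩_B` gives the Parseval identity. -/
theorem exists_isParseval (h : IsEquivalenceBimodule A B F) (hσ : IsSigmaUnital A) :
    ∃ ξ : ℕ → F, IsParseval Bᵐᵒᵖ ξ := by
  obtain ⟨p, d, hpP, hd, hpd, hu⟩ := (isConjCone_inner_self h.full_left).exists_strict_unit hσ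
  choose g hg using hpP
  refine ⟨fun n => g (Nat.pairEquiv.symm n), fun η => ?_⟩
  have hs := hasSum_of_strict_unit (fun i => by rw [hg]; exact CStarModule.inner_self_nonneg) hd
    hpd hu (matrixCoeff A B η η) (fun c hc => h.inner_smul_nonneg hc η)
    (x := inner Bᵐᵒᵖ η η) fun l hl =>
      ((CStarModule.innerSL (A := Bᵐᵒᵖ) η).continuous.tendsto η).comp (tendsto_op_smul hl η)
  refine (Equiv.hasSum_iff Nat.pairEquiv.symm (f := fun i =>
    (inner Bᵐᵒᵖ (g i) η * inner Bᵐᵒᵖ η (g i) : Bᵐᵒᵖ))).mpr (hs.congr_fun fun i => ?_)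
  rw [matrixCoeff_apply, hg, h.inner_smul_self]

end IsEquivalenceBimodule

theorem isEquivalenceBimodule_self (A : Type*) [NonUnitalCStarAlgebra A] [PartialOrder A]
    [StarOrderedRing A] : IsEquivalenceBimodule A A A where
  smul_comm a b ξ := (mul_assoc a ξ b).symm
  inner_smul ξ η ζ := mul_assoc ξ (star η) ζ
  full_left := by
    intro a
    have hua := CStarAlgebra.increasingApproximateUnit A
    have := hua.neBot
    exact mem_closure_of_tendsto (hua.tendsto_mul_left a) (Eventually.of_forall fun u =>
      Submodule.subset_span ⟨a, star u, by
        change _ = a * star (star u)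
        rw [star_star]⟩)
  full_right := by
    intro a
    have hua := CStarAlgebra.increasingApproximateUnit A
    have := hua.neBot
    exact mem_closure_of_tendsto (hua.tendsto_mul_right a) (Eventually.of_forall fun u =>
      Submodule.subset_span ⟨star u, a, by
        change _ = star (star u) * a
        rw [star_star]⟩)

/-- A Parseval frame of `A` over itself, placed in every summand, is one of `H_A`. -/
theorem exists_isCountableBasis_standardModule (hσ : IsSigmaUnital A) :
    ∃ ξ : ℕ → StandardModule A, IsCountableBasis A ξ := by
  obtain ⟨ξ, hξ⟩ := (isEquivalenceBimodule_self A).exists_isParseval hσ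
  exact ⟨_, hξ.hilbertSum.isCountableBasis⟩

namespace IsEquivalenceBimodule

theorem exists_isometry_to_standardModule (h : IsEquivalenceBimodule A B F)
    (hσ : IsSigmaUnital A) : ∃ V : HilbertSum Bᵐᵒᵖ F →ₗᵢ[ℂ] StandardModule B,
      ∀ x y, (inner Bᵐᵒᵖ (V x) (V y) : Bᵐᵒᵖ) = inner Bᵐᵒᵖ x y := by
  obtain ⟨ξ, hξ⟩ := h.exists_isParseval hσ
  obtain ⟨V, hV, -⟩ := hξ.hilbertSum.exists_isometry
  exact ⟨V, hV⟩

/-- Fullness on the right yields `g` in `F` with `∑ ⟨gᵢ, gᵢ⟩_B = 1` strictly, so `x ↦ (gᵢ xₙ)` over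
all pairs `(n, i)` preserves inner products. -/
theorem exists_isometry_from_standardModule (h : IsEquivalenceBimodule A B F)
    (hσ : IsSigmaUnital B) : ∃ W : StandardModule B →ₗᵢ[ℂ] HilbertSum Bᵐᵒᵖ F,
      ∀ x y, (inner Bᵐᵒᵖ (W x) (W y) : Bᵐᵒᵖ) = inner Bᵐᵒᵖ x y := by
  obtain ⟨g, hg⟩ := exists_hasSum_inner_self h.dense_op hσ.op
  have hsum : ∀ x : StandardModule B, HasSum (fun k =>
      (inner Bᵐᵒᵖ (op (x (Nat.pairEquiv.symm k).1) • g (Nat.pairEquiv.symm k).2)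
        (op (x (Nat.pairEquiv.symm k).1) • g (Nat.pairEquiv.symm k).2) : Bᵐᵒᵖ))
      (inner Bᵐᵒᵖ x x) := fun x => by
    refine (Equiv.hasSum_iff Nat.pairEquiv.symm (f := fun i : ℕ × ℕ =>
      (inner Bᵐᵒᵖ (op (x i.1) • g i.2) (op (x i.1) • g i.2) : Bᵐᵒᵖ))).mpr ?_
    refine hasSum_prod_of_nonneg (fun i => CStarModule.inner_self_nonneg) (fun n => ?_)
      x.summable_self.hasSum
    refine (hg (op (x n))).congr_fun fun i => ?_
    simp [mul_assoc]
  let W₀ : StandardModule B →ₗ[ℂ] HilbertSum Bᵐᵒᵖ F :=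
    { toFun := fun x => HilbertSum.mk
        (fun k => op (x (Nat.pairEquiv.symm k).1) • g (Nat.pairEquiv.symm k).2) (hsum x).summable
      map_add' := fun x y => HilbertSum.ext fun k => by
        simp only [HilbertSum.mk_apply, HilbertSum.add_apply, op_add, op_add_smul]
      map_smul' := fun c x => HilbertSum.ext fun k => by
        simp only [HilbertSum.mk_apply, HilbertSum.smul_apply, op_smul, op_complex_smul_smul,
          RingHom.id_apply] }
  have hW₀ : ∀ x, (inner Bᵐᵒᵖ (W₀ x) (W₀ x) : Bᵐᵒᵖ) = inner Bᵐᵒᵖ x x := fun x =>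
    (hsum x).tsum_eq
  exact ⟨isometryOfInner W₀ hW₀, inner_map_map_of_self W₀ hW₀⟩

end IsEquivalenceBimodule

end Bimodule

end CStarFund

namespace CStarFund

open CompactOperators MulOpposite

/-! ### The tensor product of the standard module with the bimodule -/

section Tensor

variable {A B F : Type*}
    [NonUnitalCStarAlgebra A] [PartialOrder A] [StarOrderedRing A]
    [NonUnitalCStarAlgebra B] [PartialOrder B] [StarOrderedRing B]
    [NormedAddCommGroup F] [NormedSpace ℂ F] [CompleteSpace F] [SMul A F] [SMul Bᵐᵒᵖ F]
    [CStarModule A F] [CStarModule Bᵐᵒᵖ F]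

namespace IsEquivalenceBimodule

/-- The continuous map `a ↦ ⟨f, a f'⟩_B` is applied to the series `∑ ζₙ⋆ ζ'ₙ`. -/
theorem hasSum_inner_tensor (h : IsEquivalenceBimodule A B F) (ζ ζ' : StandardModule A)
    (f f' : F) : HasSum (fun n => (inner Bᵐᵒᵖ (ζ n • f) (ζ' n • f') : Bᵐᵒᵖ))
      (inner Bᵐᵒᵖ f ((unop (inner Aᵐᵒᵖ ζ ζ') : A) • f')) := by
  have h1 := (matrixCoeff A B f f').hasSum (HilbertSum.summable_inner ζ ζ').hasSum.unop
  refine h1.congr_fun fun n => ?_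
  rw [h.inner_smul_left, ← op_mul_smul]
  rfl

/-- The elementary tensor `ζ ⊗ f`, realized as the sequence `ζₙ f` in `F ⊕ F ⊕ ⋯`. -/
noncomputable def tensor (h : IsEquivalenceBimodule A B F) (ζ : StandardModule A) (f : F) :
    HilbertSum Bᵐᵒᵖ F :=
  HilbertSum.mk (fun n => ζ n • f) (h.hasSum_inner_tensor ζ ζ f f).summable

variable (h : IsEquivalenceBimodule A B F)
include h

theorem tensor_apply (ζ : StandardModule A) (f : F) (n : ℕ) : h.tensor ζ f n = ζ n • f := rfl

theorem inner_tensor (ζ ζ' : StandardModule A) (f f' : F) :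
    (inner Bᵐᵒᵖ (h.tensor ζ f) (h.tensor ζ' f') : Bᵐᵒᵖ) =
      inner Bᵐᵒᵖ f ((unop (inner Aᵐᵒᵖ ζ ζ') : A) • f') :=
  (h.hasSum_inner_tensor ζ ζ' f f').tsum_eq

theorem norm_tensor_le (ζ : StandardModule A) (f : F) : ‖h.tensor ζ f‖ ≤ ‖ζ‖ * ‖f‖ := by
  refine le_of_sq_le_sq ?_ (by positivity)
  rw [CStarModule.norm_sq_eq Bᵐᵒᵖ (E := HilbertSum Bᵐᵒᵖ F), h.inner_tensor]
  calc ‖(inner Bᵐᵒᵖ f ((unop (inner Aᵐᵒᵖ ζ ζ) : A) • f) : Bᵐᵒᵖ)‖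
      ≤ ‖f‖ * ‖(unop (inner Aᵐᵒᵖ ζ ζ) : A) • f‖ := CStarModule.norm_inner_le F
    _ ≤ ‖f‖ * (‖(unop (inner Aᵐᵒᵖ ζ ζ) : A)‖ * ‖f‖) := by gcongr; exact norm_op_smul_le _ _
    _ = ‖f‖ * (‖ζ‖ ^ 2 * ‖f‖) := by
      rw [norm_unop, ← CStarModule.norm_sq_eq Aᵐᵒᵖ (E := StandardModule A)]
    _ = _ := by ring

/-- The elementary tensors as a continuous bilinear map. -/
noncomputable def tensorCLM : StandardModule A →L[ℂ] F →L[ℂ] HilbertSum Bᵐᵒᵖ F :=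
  LinearMap.mkContinuous₂
    (LinearMap.mk₂ ℂ h.tensor
      (fun a b f => HilbertSum.ext fun n => by
        simp only [tensor_apply, HilbertSum.add_apply, op_add_smul])
      (fun c a f => HilbertSum.ext fun n => by
        simp only [tensor_apply, HilbertSum.smul_apply, op_complex_smul_smul])
      (fun a f g => HilbertSum.ext fun n => by
        simp only [tensor_apply, HilbertSum.add_apply, op_smul_add])
      (fun c a f => HilbertSum.ext fun n => by
        simp only [tensor_apply, HilbertSum.smul_apply, op_smul_smul_comm]))
    1 fun ζ f => by
      rw [one_mul]
      exact h.norm_tensor_le ζ f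

theorem tensorCLM_apply (ζ : StandardModule A) (f : F) : h.tensorCLM ζ f = h.tensor ζ f := rfl

/-- Finitely supported sequences are dense, and `f` in one summand is the limit of the tensors `u f`
along an approximate unit of `A`. -/
theorem dense_span_tensor :
    Dense (Submodule.span ℂ {x | ∃ ζ f, x = h.tensor ζ f} : Set (HilbertSum Bᵐᵒᵖ F)) := by
  let M := (Submodule.span ℂ {x | ∃ ζ f, x = h.tensor ζ f}).topologicalClosure
  have hsingle : ∀ n f, HilbertSum.single n f ∈ M := fun n f => by
    have hua := CStarAlgebra.increasingApproximateUnit A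
    have := hua.neBot
    refine mem_closure_of_tendsto (((HilbertSum.continuous_single (R := Bᵐᵒᵖ) n).tendsto f).comp
      (tendsto_op_smul hua.toIsApproximateUnit f)) (Eventually.of_forall fun u => ?_)
    refine Submodule.subset_span ⟨HilbertSum.single n u, f, HilbertSum.ext fun m => ?_⟩
    simp only [Function.comp_apply, HilbertSum.single_apply, tensor_apply]
    split_ifs with hm
    · rfl
    · rw [op_zero_smul]
  intro x
  refine (isClosed_closure).mem_of_tendsto (HilbertSum.tendsto_trunc x)
    (Eventually.of_forall fun n => ?_)
  rw [HilbertSum.trunc_range_eq_sum]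
  exact M.sum_mem fun i _ => hsingle i (x i)

theorem tensor_eq_zero {ζ : StandardModule A} (hζ : ∀ f, h.tensor ζ f = 0) : ζ = 0 :=
  HilbertSum.ext fun n => h.left_faithful fun f => by
    rw [← h.tensor_apply, hζ, HilbertSum.zero_apply]

theorem eq_zero_of_act_tensor {T : CompactOperators Bᵐᵒᵖ (HilbertSum Bᵐᵒᵖ F)}
    (hT : ∀ ζ f, T.act (h.tensor ζ f) = 0) : T = 0 := by
  refine ext_act fun x => ?_
  let M : Submodule ℂ (HilbertSum Bᵐᵒᵖ F) := LinearMap.ker T.act.toLinearMap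
  have hM : IsClosed (M : Set (HilbertSum Bᵐᵒᵖ F)) :=
    isClosed_singleton.preimage T.act.continuous
  have hle : Submodule.span ℂ {x | ∃ ζ f, x = h.tensor ζ f} ≤ M := by
    refine Submodule.span_le.mpr ?_
    rintro _ ⟨ζ, f, rfl⟩
    exact hT ζ f
  exact closure_minimal hle hM (h.dense_span_tensor x)

/-- This is `θ_{ζ₀⊗f, ζ'⊗g} = θ_{ζ₀ a, ζ'} ⊗ 1` with `a = _A⟨f, g⟩`: the compatibility of the two
inner products moves the `B`-valued coefficient to the `A`-side. -/
theorem theta_tensor_act (ζ₀ ζ' ζ : StandardModule A) (f g k : F) :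
    (theta Bᵐᵒᵖ (h.tensor ζ₀ f) (h.tensor ζ' g)).act (h.tensor ζ k) =
      h.tensor ((theta Aᵐᵒᵖ ((op (inner A g f : A) : Aᵐᵒᵖ) • ζ₀) ζ').act ζ) k := by
  rw [theta_act, theta_act, h.inner_tensor]
  refine HilbertSum.ext fun n => ?_
  rw [HilbertSum.op_smul_apply, tensor_apply, tensor_apply, HilbertSum.op_smul_apply,
    HilbertSum.op_smul_apply, ← op_unop (inner Bᵐᵒᵖ g ((unop (inner Aᵐᵒᵖ ζ' ζ) : A) • k)),
    ← h.smul_comm, op_unop, ← h.inner_smul, ← op_mul_smul, ← op_mul_smul]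
  rfl

theorem mem_of_theta_tensor_mem {Q : Submodule ℂ (CompactOperators Bᵐᵒᵖ (HilbertSum Bᵐᵒᵖ F))}
    (hQ : IsClosed (Q : Set (CompactOperators Bᵐᵒᵖ (HilbertSum Bᵐᵒᵖ F))))
    (hm : ∀ ζ f ζ' g, theta Bᵐᵒᵖ (h.tensor ζ f) (h.tensor ζ' g) ∈ Q)
    (T : CompactOperators Bᵐᵒᵖ (HilbertSum Bᵐᵒᵖ F)) : T ∈ Q := by
  let Θ := thetaCLM Bᵐᵒᵖ (HilbertSum Bᵐᵒᵖ F)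
  have h1 : ∀ ζ f y, theta Bᵐᵒᵖ (h.tensor ζ f) y ∈ Q := fun ζ f y => by
    have hle : Submodule.span ℂ {x | ∃ ζ f, x = h.tensor ζ f} ≤
        Q.comap (Θ (h.tensor ζ f)).toLinearMap := by
      refine Submodule.span_le.mpr ?_
      rintro _ ⟨ζ', g, rfl⟩
      exact hm ζ f ζ' g
    exact closure_minimal hle (hQ.preimage (Θ (h.tensor ζ f)).continuous) (h.dense_span_tensor y)
  have h2 : ∀ x y, theta Bᵐᵒᵖ x y ∈ Q := fun x y => by
    have hle : Submodule.span ℂ {x | ∃ ζ f, x = h.tensor ζ f} ≤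
        Q.comap (Θ.flip y).toLinearMap := by
      refine Submodule.span_le.mpr ?_
      rintro _ ⟨ζ, f, rfl⟩
      exact h1 ζ f y
    exact closure_minimal hle (hQ.preimage (Θ.flip y).continuous) (h.dense_span_tensor x)
  have hle : Submodule.span ℂ {T | ∃ x y, T = theta Bᵐᵒᵖ x y} ≤ Q := by
    refine Submodule.span_le.mpr ?_
    rintro _ ⟨x, y, rfl⟩
    exact h2 x y
  exact closure_minimal hle hQ (dense_span_theta Bᵐᵒᵖ (HilbertSum Bᵐᵒᵖ F) T)

/-- The isomorphism of `K(H_A)` with the compact operators on `H_A ⊗ F = F ⊕ F ⊕ ⋯`. -/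
theorem exists_starHom_tensor :
    ∃ φ : Stabilization A →⋆ₙₐ[ℂ] CompactOperators Bᵐᵒᵖ (HilbertSum Bᵐᵒᵖ F),
      Function.Bijective φ ∧
      (∀ T ζ f, (φ T).act (h.tensor ζ f) = h.tensor (T.act ζ) f) ∧
      ∀ ζ ζ' f g, φ (theta Aᵐᵒᵖ ((op (inner A g f : A) : Aᵐᵒᵖ) • ζ) ζ') =
        theta Bᵐᵒᵖ (h.tensor ζ f) (h.tensor ζ' g) := by
  let KA := Stabilization A
  let KE := CompactOperators Bᵐᵒᵖ (HilbertSum Bᵐᵒᵖ F)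
  have tadd : ∀ ζ ζ' f, h.tensor (ζ + ζ') f = h.tensor ζ f + h.tensor ζ' f := fun ζ ζ' f => by
    simp only [← tensorCLM_apply, map_add, add_apply]
  have tsmul : ∀ (c : ℂ) ζ f, h.tensor (c • ζ) f = c • h.tensor ζ f := fun c ζ f => by
    simp only [← tensorCLM_apply, map_smul, smul_apply]
  have tzero : ∀ f, h.tensor 0 f = 0 := fun f => by
    simp only [← tensorCLM_apply, map_zero, zero_apply]
  -- The graph of `T ↦ T ⊗ 1`.
  let S : NonUnitalStarSubalgebra ℂ (KA × KE) :=
    { carrier := {p | (∀ ζ f, p.2.act (h.tensor ζ f) = h.tensor (p.1.act ζ) f) ∧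
        ∀ ζ f, (star p.2).act (h.tensor ζ f) = h.tensor ((star p.1).act ζ) f}
      add_mem' := by
        rintro ⟨a, a'⟩ ⟨b, b'⟩ ⟨h1, h2⟩ ⟨k1, k2⟩
        refine ⟨fun x f => ?_, fun x f => ?_⟩
        · have := congrArg₂ (· + ·) (h1 x f) (k1 x f)
          exact this.trans (tadd _ _ f).symm
        · have := congrArg₂ (· + ·) (h2 x f) (k2 x f)
          simp only [Prod.mk_add_mk, star_add]
          exact this.trans (tadd _ _ f).symm
      zero_mem' := by
        refine ⟨fun x f => (tzero f).symm, fun x f => ?_⟩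
        simp only [Prod.fst_zero, Prod.snd_zero, star_zero]
        exact (tzero f).symm
      mul_mem' := by
        rintro ⟨a, a'⟩ ⟨b, b'⟩ ⟨h1, h2⟩ ⟨k1, k2⟩
        refine ⟨fun x f => ?_, fun x f => ?_⟩
        · exact (congrArg a'.act (k1 x f)).trans (h1 _ f)
        · simp only [Prod.mk_mul_mk, star_mul]
          exact (congrArg (star b').act (h2 x f)).trans (k2 _ f)
      smul_mem' := by
        rintro c ⟨a, a'⟩ ⟨h1, h2⟩
        refine ⟨fun x f => ?_, fun x f => ?_⟩
        · exact (congrArg (c • ·) (h1 x f)).trans (tsmul c _ f).symm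
        · simp only [Prod.smul_mk, star_smul]
          exact (congrArg (star c • ·) (h2 x f)).trans (tsmul _ _ f).symm
      star_mem' := by
        rintro ⟨a, a'⟩ ⟨h1, h2⟩
        refine ⟨h2, fun x f => ?_⟩
        have := h1 x f
        simpa only [Prod.star_def, star_star] using this }
  have tcont : ∀ f, Continuous fun ζ => h.tensor ζ f := fun f =>
    (h.tensorCLM.flip f).continuous
  have hS : IsClosed (S : Set (KA × KE)) := by
    have hset : (S : Set (KA × KE)) =
        (⋂ ζ, ⋂ f, {p | p.2.act (h.tensor ζ f) = h.tensor (p.1.act ζ) f}) ∩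
          ⋂ ζ, ⋂ f, {p | (star p.2).act (h.tensor ζ f) = h.tensor ((star p.1).act ζ) f} := by
      ext p
      simp only [Set.mem_inter_iff, Set.mem_iInter, Set.mem_ofPred_eq]
      rfl
    rw [hset]
    refine IsClosed.inter (isClosed_iInter fun ζ => isClosed_iInter fun f => isClosed_eq ?_ ?_)
      (isClosed_iInter fun ζ => isClosed_iInter fun f => isClosed_eq ?_ ?_)
    · exact (continuous_act _).comp continuous_snd
    · exact (tcont f).comp ((continuous_act ζ).comp continuous_fst)
    · exact (continuous_act _).comp (continuous_star.comp continuous_snd)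
    · exact (tcont f).comp ((continuous_act ζ).comp (continuous_star.comp continuous_fst))
  have hθ : ∀ ζ ζ' f g, ((theta Aᵐᵒᵖ ((op (inner A g f : A) : Aᵐᵒᵖ) • ζ) ζ',
      theta Bᵐᵒᵖ (h.tensor ζ f) (h.tensor ζ' g)) : KA × KE) ∈ S := fun ζ ζ' f g => by
    refine ⟨fun x k => h.theta_tensor_act ζ ζ' x f g k, fun x k => ?_⟩
    change (star (theta Bᵐᵒᵖ (h.tensor ζ f) (h.tensor ζ' g))).act (h.tensor x k) =
      h.tensor ((star (theta Aᵐᵒᵖ ((op (inner A g f : A) : Aᵐᵒᵖ) • ζ) ζ')).act x) k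
    rw [star_theta, star_theta, theta_tensor_act, theta_op_smul, ← op_star, CStarModule.star_inner]
  obtain ⟨φ, hφ, hgraph⟩ := exists_starHom_of_graph S hS
    (fun T hT => ext_act fun ζ => h.tensor_eq_zero fun f => by
      rw [← hT.1 ζ f]; rfl)
    (fun T hT => h.eq_zero_of_act_tensor fun ζ f => (hT.1 ζ f).trans (tzero f))
    (by
      let P : Submodule ℂ KA := S.toNonUnitalSubalgebra.toSubmodule.map (LinearMap.fst ℂ _ _)
      -- The graph is known to contain only `θ_{ζ a, ζ'}` with `a` a left inner product. Left
      -- fullness gives all `a`, and an approximate unit then removes `a`.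
      have hP : ∀ (r : Aᵐᵒᵖ) ζ ζ', theta Aᵐᵒᵖ (r • ζ) ζ' ∈ P.topologicalClosure := fun r ζ ζ' => by
        let L : A →L[ℂ] KA := ((thetaCLM Aᵐᵒᵖ (StandardModule A)).flip ζ').comp
          (((opSMulCLM Aᵐᵒᵖ (StandardModule A)).flip ζ).comp
            (opContinuousLinearEquiv ℂ : A ≃L[ℂ] Aᵐᵒᵖ).toContinuousLinearMap)
        have hL : Submodule.span ℂ {a : A | ∃ ξ η : F, a = inner A η ξ} ≤
            P.topologicalClosure.comap L.toLinearMap := by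
          refine Submodule.span_le.mpr ?_
          rintro _ ⟨ξ, η, rfl⟩
          exact subset_closure ⟨_, hθ ζ ζ' ξ η, rfl⟩
        exact closure_minimal hL (P.isClosed_topologicalClosure.preimage L.continuous)
          (h.full_left (unop r))
      have hP' : ∀ ζ ζ', theta Aᵐᵒᵖ ζ ζ' ∈ P.topologicalClosure := fun ζ ζ' => by
        have hua := CStarAlgebra.increasingApproximateUnit Aᵐᵒᵖ
        have := hua.neBot
        have h2 := (((thetaCLM Aᵐᵒᵖ (StandardModule A)).flip ζ').continuous.tendsto ζ).comp
          (tendsto_op_smul hua.toIsApproximateUnit ζ)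
        exact P.isClosed_topologicalClosure.mem_of_tendsto h2
          (Eventually.of_forall fun r => hP r ζ ζ')
      have hle : Submodule.span ℂ {T : KA | ∃ ξ η, T = theta Aᵐᵒᵖ ξ η} ≤
          P.topologicalClosure := by
        refine Submodule.span_le.mpr ?_
        rintro _ ⟨ξ, η, rfl⟩
        exact hP' ξ η
      intro T
      exact closure_minimal hle P.isClosed_topologicalClosure
        (dense_span_theta Aᵐᵒᵖ (StandardModule A) T))
  have hφθ := fun ζ ζ' f g => (hgraph _ _).mp (hθ ζ ζ' f g)
  refine ⟨φ, ⟨hφ, ?_⟩, fun T ζ f => ((hgraph T (φ T)).mpr rfl).1 ζ f, hφθ⟩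
  let Q : Submodule ℂ KE := LinearMap.range (LinearMapClass.linearMap φ)
  have hQ : IsClosed (Q : Set KE) := range_isClosed_of_injective φ hφ
  exact h.mem_of_theta_tensor_mem hQ fun ζ f ζ' g => ⟨_, hφθ ζ ζ' f g⟩

/-- Conjugation invariance rests on surjectivity of `T ↦ T ⊗ 1`: every compact operator on `F^∞`
maps `ζ ⊗ f` to the elementary tensor `Tζ ⊗ f`. Density follows by polarizing in each tensor factor
separately. -/
theorem isConjCone_theta_tensor :
    IsConjCone {T | ∃ ζ f, T = theta Bᵐᵒᵖ (h.tensor ζ f) (h.tensor ζ f)} where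
  zero_mem := ⟨0, 0, by
    have : h.tensor 0 0 = 0 := by simp only [← tensorCLM_apply, map_zero]
    rw [this]
    exact ext_act fun x => by rw [theta_act, op_smul_zero, act_zero]⟩
  nonneg := by
    rintro _ ⟨ζ, f, rfl⟩
    exact theta_self_nonneg _
  conj := by
    obtain ⟨φ, hφ, hφt, -⟩ := h.exists_starHom_tensor
    rintro c _ ⟨ζ, f, rfl⟩
    obtain ⟨T, rfl⟩ := hφ.2 c
    exact ⟨T.act ζ, f, by rw [mul_theta, theta_mul, star_star, hφt]⟩
  smul := by
    rintro r hr _ ⟨ζ, f, rfl⟩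
    refine ⟨(√r : ℂ) • ζ, f, ?_⟩
    rw [real_smul_theta_self hr]
    simp only [← tensorCLM_apply, map_smul, smul_apply]
  dense := by
    let S := Submodule.span ℂ {T | ∃ ζ f, T = theta Bᵐᵒᵖ (h.tensor ζ f) (h.tensor ζ f)}
    let Θ := thetaCLM Bᵐᵒᵖ (HilbertSum Bᵐᵒᵖ F)
    have h1 : ∀ ζ ζ' f, theta Bᵐᵒᵖ (h.tensor ζ f) (h.tensor ζ' f) ∈ S := fun ζ ζ' f => by
      let B' : StandardModule A →ₗ[ℂ] StandardModule A →ₗ⋆[ℂ] _ :=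
        LinearMap.mk₂'ₛₗ (RingHom.id ℂ) (starRingEnd ℂ)
          (fun ζ ζ' => Θ (h.tensorCLM ζ f) (h.tensorCLM ζ' f))
          (by simp) (by simp) (by simp) (by simp)
      exact polarization_mem B' S (fun ζ => Submodule.subset_span ⟨ζ, f, rfl⟩) ζ ζ'
    have h2 : ∀ ζ f ζ' g, theta Bᵐᵒᵖ (h.tensor ζ f) (h.tensor ζ' g) ∈ S := fun ζ f ζ' g => by
      let B' : F →ₗ[ℂ] F →ₗ⋆[ℂ] _ :=
        LinearMap.mk₂'ₛₗ (RingHom.id ℂ) (starRingEnd ℂ)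
          (fun f g => Θ (h.tensorCLM ζ f) (h.tensorCLM ζ' g))
          (by simp) (by simp) (by simp) (by simp)
      exact polarization_mem B' S (fun f => h1 ζ ζ' f) f g
    exact fun T => h.mem_of_theta_tensor_mem S.isClosed_topologicalClosure
      (fun ζ f ζ' g => subset_closure (h2 ζ f ζ' g)) T

end IsEquivalenceBimodule

end Tensor

end CStarFund

namespace CStarFund

open CompactOperators MulOpposite

/-! ### Transport of the trace through the bimodule -/

namespace IsEquivalenceBimodule

variable {A B F : Type*}
    [NonUnitalCStarAlgebra A] [PartialOrder A] [StarOrderedRing A]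
    [NonUnitalCStarAlgebra B] [PartialOrder B] [StarOrderedRing B]
    [NormedAddCommGroup F] [NormedSpace ℂ F] [CompleteSpace F] [SMul A F] [SMul Bᵐᵒᵖ F]
    [CStarModule A F] [CStarModule Bᵐᵒᵖ F]

theorem inner_op_smul_left' (h : IsEquivalenceBimodule A B F) (b : Bᵐᵒᵖ) (ξ η : F) :
    (inner A (b • ξ) η : A) = inner A ξ (star b • η) := by
  rw [← sub_eq_zero]
  refine h.left_faithful fun ζ => ?_
  rw [op_sub_smul, sub_eq_zero, h.inner_smul, h.inner_smul, CStarModule.inner_op_smul_left,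
    op_mul_smul]

theorem trace_inner_self_eq_tsum {ξ : ℕ → F} (hξ : IsParseval Bᵐᵒᵖ ξ) (τ : Trace B)
    (hτ : LowerSemicontinuous τ) (η : F) :
    τ ⟨unop (inner Bᵐᵒᵖ η η), unop_nonneg.mpr CStarModule.inner_self_nonneg⟩ =
      ∑' i, τ ⟨star (unop (inner Bᵐᵒᵖ (ξ i) η)) * unop (inner Bᵐᵒᵖ (ξ i) η),
        star_mul_self_nonneg _⟩ := by
  refine τ.eq_tsum hτ (fun i => star_mul_self_nonneg (unop (inner Bᵐᵒᵖ (ξ i) η))) _ ?_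
  refine (hξ η).unop.tendsto_sum_nat.congr fun n => Finset.sum_congr rfl fun i _ => ?_
  rw [unop_mul, ← unop_star, CStarModule.star_inner]

/-- The trace `a ↦ ∑ τ (⟨ξᵢ, a ξᵢ⟩_B)` on `A` induced by a trace `τ` on `B`, where `ξ` is a Parseval
frame of the bimodule. -/
noncomputable def pullbackTrace (h : IsEquivalenceBimodule A B F) {ξ : ℕ → F}
    (hξ : IsParseval Bᵐᵒᵖ ξ) (τ : Trace B) (hτ : LowerSemicontinuous τ) : Trace A where
  toFun a := ∑' i, τ ⟨unop (inner Bᵐᵒᵖ (ξ i) (a.1 • ξ i)),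
    unop_nonneg.mpr (h.inner_smul_nonneg a.2 (ξ i))⟩
  map_zero := ENNReal.tsum_eq_zero.mpr fun i =>
    (τ.congr _ (by rw [op_zero_smul, CStarModule.inner_zero_right, unop_zero])).trans τ.map_zero
  map_add a b := by
    rw [← ENNReal.tsum_add]
    refine tsum_congr fun i => ?_
    rw [← τ.map_add]
    exact τ.congr _ (by rw [op_add_smul, CStarModule.inner_add_right, unop_add])
  map_smul r a := by
    rw [← ENNReal.tsum_mul_left]
    refine tsum_congr fun i => ?_
    rw [← τ.map_smul]
    refine τ.congr _ ?_
    change unop (inner Bᵐᵒᵖ (ξ i) (((r : ℝ) • a.1) • ξ i)) =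
      (r : ℝ) • unop (inner Bᵐᵒᵖ (ξ i) (a.1 • ξ i))
    rw [← Complex.coe_smul, op_complex_smul_smul, CStarModule.inner_smul_right_complex, unop_smul,
      Complex.coe_smul]
  map_star_mul_self a := by
    -- Expanding `⟨a ξᵢ, a ξᵢ⟩` in the frame gives the double sum of `τ(|⟨ξⱼ, a ξᵢ⟩|²)`. Replacing
    -- `a` by `a⋆` exchanges `i` and `j` up to an adjoint, which `τ` ignores.
    have key : ∀ a : A, ∑' i, τ ⟨unop (inner Bᵐᵒᵖ (ξ i) ((star a * a) • ξ i)),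
        unop_nonneg.mpr (h.inner_smul_nonneg (star_mul_self_nonneg a) (ξ i))⟩ =
        ∑' i, ∑' j, τ ⟨star (unop (inner Bᵐᵒᵖ (ξ j) (a • ξ i))) *
          unop (inner Bᵐᵒᵖ (ξ j) (a • ξ i)), star_mul_self_nonneg _⟩ := fun a => by
      refine tsum_congr fun i => ?_
      rw [← trace_inner_self_eq_tsum hξ τ hτ]
      exact τ.congr _ (by rw [op_mul_smul, ← h.inner_smul_left])
    have key' := key (star a)
    simp only [star_star] at key'
    refine (key a).trans (Eq.trans ?_ key'.symm)
    rw [ENNReal.tsum_comm]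
    refine tsum_congr fun i => tsum_congr fun j => ?_
    rw [τ.map_star_mul_self]
    refine τ.congr _ ?_
    have e : (inner Bᵐᵒᵖ (ξ j) (star a • ξ i) : Bᵐᵒᵖ) = star (inner Bᵐᵒᵖ (ξ i) (a • ξ j)) := by
      rw [← h.inner_smul_left, CStarModule.star_inner]
    rw [e, unop_star, star_star]

variable (h : IsEquivalenceBimodule A B F) {ξ : ℕ → F} (hξ : IsParseval Bᵐᵒᵖ ξ) (τ : Trace B)
  (hτ : LowerSemicontinuous τ)

theorem lowerSemicontinuous_pullbackTrace : LowerSemicontinuous (h.pullbackTrace hξ τ hτ) := by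
  refine lowerSemicontinuous_tsum fun i => hτ.comp ?_
  refine Continuous.subtype_mk ?_ _
  exact continuous_unop.comp ((matrixCoeff A B (ξ i) (ξ i)).continuous.comp continuous_subtype_val)

/-- Each term is `τ` of `⟨ξᵢ, f⟩ ⟨f, ξᵢ⟩`; exchanging the factors under `τ` leaves the Parseval
expansion of `⟨f, f⟩_B`. -/
theorem pullbackTrace_inner_self (f : F) :
    h.pullbackTrace hξ τ hτ ⟨inner A f f, CStarModule.inner_self_nonneg⟩ =
      τ ⟨unop (inner Bᵐᵒᵖ f f), unop_nonneg.mpr CStarModule.inner_self_nonneg⟩ := by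
  rw [trace_inner_self_eq_tsum hξ τ hτ]
  refine tsum_congr fun i => ?_
  rw [τ.map_star_mul_self]
  exact τ.congr _ (by rw [h.inner_smul_self, unop_mul, ← unop_star, CStarModule.star_inner])

/-- If `τ(b) < ∞` and `y = b^{1/2}`, then `_A⟨f b, f⟩ = _A⟨f y, f y⟩` has trace `τ(y ⟨f, f⟩ y) ≤
‖⟨f, f⟩‖ τ(b)`. Polarization, density of the domain of `τ`, an approximate unit of `B` and left
fullness then reach all of `A`. -/
theorem isDenselyDefined_pullbackTrace (hd : τ.IsDenselyDefined) :
    (h.pullbackTrace hξ τ hτ).IsDenselyDefined := by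
  set σ := h.pullbackTrace hξ τ hτ
  set S := Submodule.span ℂ {a : A | ∃ ha : 0 ≤ a, σ ⟨a, ha⟩ < ∞}
  have h1 : ∀ b : B, (∃ hb : 0 ≤ b, τ ⟨b, hb⟩ < ∞) → ∀ f : F, (inner A f (op b • f) : A) ∈ S := by
    rintro b ⟨hb, hτb⟩ f
    set y := CFC.sqrt b
    have hys : star y = y := (IsSelfAdjoint.of_nonneg (CFC.sqrt_nonneg _)).star_eq
    have hyy : y * y = b := CFC.sqrt_mul_sqrt_self _ hb
    have e : (inner A f (op b • f) : A) = inner A (op y • f) (op y • f) := by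
      rw [h.inner_op_smul_left', ← op_star, hys, ← op_mul_smul, ← op_mul, hyy]
    refine Submodule.subset_span ⟨e ▸ CStarModule.inner_self_nonneg, ?_⟩
    rw [σ.congr _ e, h.pullbackTrace_inner_self hξ τ hτ]
    set r : ℝ≥0 := ‖unop (inner Bᵐᵒᵖ f f)‖₊
    have hle : unop (inner Bᵐᵒᵖ (op y • f) (op y • f)) ≤ (r : ℝ) • b := by
      have h2 := CStarAlgebra.star_left_conjugate_le_norm_smul (a := y)
        (b := unop (inner Bᵐᵒᵖ f f)) (IsSelfAdjoint.of_nonneg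
          (unop_nonneg.mpr CStarModule.inner_self_nonneg))
      rw [hys, hyy] at h2
      have h3 : (r : ℝ) = ‖unop (inner Bᵐᵒᵖ f f)‖ := rfl
      rw [h3]
      simpa [hys, mul_assoc] using h2
    refine (τ.mono _ hle).trans_lt ?_
    rw [τ.map_smul r ⟨b, hb⟩]
    exact ENNReal.mul_lt_top ENNReal.coe_lt_top hτb
  have h2 : ∀ b : B, (∃ hb : 0 ≤ b, τ ⟨b, hb⟩ < ∞) → ∀ f g : F,
      (inner A f (op b • g) : A) ∈ S := fun b hb f g => by
    let B' : F →ₗ[ℂ] F →ₗ⋆[ℂ] A :=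
      LinearMap.mk₂'ₛₗ (RingHom.id ℂ) (starRingEnd ℂ) (fun g f => inner A f (op b • g))
        (by simp [op_smul_add]) (by simp [op_smul_smul_comm]) (by simp) (by simp)
    exact polarization_mem B' S (h1 b hb) g f
  have h3 : ∀ (b : B) (f g : F), (inner A f (op b • g) : A) ∈ S.topologicalClosure :=
      fun b f g => by
    let L : B →L[ℂ] A := ((CStarModule.innerSL (A := A) f).comp
      ((opSMulCLM Bᵐᵒᵖ F).flip g)).comp
        (opContinuousLinearEquiv ℂ : B ≃L[ℂ] Bᵐᵒᵖ).toContinuousLinearMap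
    have hle : Submodule.span ℂ {b : B | ∃ hb : 0 ≤ b, τ ⟨b, hb⟩ < ∞} ≤
        S.topologicalClosure.comap L.toLinearMap :=
      Submodule.span_le.mpr fun b hb => subset_closure (h2 b hb f g)
    exact closure_minimal hle (S.isClosed_topologicalClosure.preimage L.continuous) (hd b)
  have h4 : ∀ f g : F, (inner A f g : A) ∈ S.topologicalClosure := fun f g => by
    have hua := CStarAlgebra.increasingApproximateUnit Bᵐᵒᵖ
    have := hua.neBot
    exact S.isClosed_topologicalClosure.mem_of_tendsto
      (((CStarModule.innerSL (A := A) f).continuous.tendsto g).comp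
        (tendsto_op_smul hua.toIsApproximateUnit g))
      (Eventually.of_forall fun b => h3 (unop b) f g)
  have hle : Submodule.span ℂ {a : A | ∃ ξ η : F, a = inner A η ξ} ≤ S.topologicalClosure := by
    refine Submodule.span_le.mpr ?_
    rintro _ ⟨ξ, η, rfl⟩
    exact h4 η ξ
  exact fun a => closure_minimal hle S.isClosed_topologicalClosure (h.full_left a)

/-- The unique traces of Morita equivalent algebras agree on `_A⟨f, f⟩` and `⟨f, f⟩_B` up to a
scalar. -/
theorem exists_scalar (h : IsEquivalenceBimodule A B F) (hσ : IsSigmaUnital A) {τA : Trace A} (hτA : τA.IsUnique) {τB : Trace B}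
    (hτB : τB.IsUnique) : ∃ c : ℝ≥0, c ≠ 0 ∧ ∀ f : F,
      τB ⟨unop (inner Bᵐᵒᵖ f f), unop_nonneg.mpr CStarModule.inner_self_nonneg⟩ =
        c * τA ⟨inner A f f, CStarModule.inner_self_nonneg⟩ := by
  obtain ⟨ξ, hξ⟩ := h.exists_isParseval hσ
  have hlsc := hτB.lowerSemicontinuous
  obtain ⟨c, hc⟩ := hτA.eq_smul (h.pullbackTrace hξ τB hlsc)
    (h.isDenselyDefined_pullbackTrace hξ τB hlsc hτB.denselyDefined)
    (h.lowerSemicontinuous_pullbackTrace hξ τB hlsc)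
  have hcf := fun f : F => (h.pullbackTrace_inner_self hξ τB hlsc f).symm.trans (hc _)
  refine ⟨c, ?_, hcf⟩
  -- For `c = 0`, `τB` would vanish on every `⟨g, g⟩_B`; series of these exhaust the positive
  -- elements of `B`, contradicting `τB ≠ 0`.
  rintro rfl
  obtain ⟨⟨b, hb⟩, hτb⟩ := hτB.ne_zero
  obtain ⟨p, hp, hsum⟩ := (isConjCone_inner_self h.dense_op).exists_hasSum (op_nonneg.mpr hb)
  choose g hg using hp
  have hp0 : ∀ i, 0 ≤ unop (p i) := fun i => by
    rw [hg]
    exact unop_nonneg.mpr CStarModule.inner_self_nonneg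
  refine hτb ((τB.eq_tsum hlsc hp0 hb hsum.unop.tendsto_sum_nat).trans
    (ENNReal.tsum_eq_zero.mpr fun i => ?_))
  rw [τB.congr _ (congrArg unop (hg i)), hcf, ENNReal.coe_zero, zero_mul]

end IsEquivalenceBimodule

end CStarFund

namespace CStarFund

open CompactOperators MulOpposite

/-! ### Comparison of the fundamental groups -/

section FundamentalGroup

variable {A B : Type*} [NonUnitalCStarAlgebra A] [PartialOrder A] [StarOrderedRing A]
    [NonUnitalCStarAlgebra B] [PartialOrder B] [StarOrderedRing B]

theorem dimensionFunction_map {τA : Trace A} {τB : Trace B}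
    (φ : Stabilization A →⋆ₙₐ[ℂ] Stabilization B) (hφ : Function.Injective φ) {c : ℝ≥0}
    (h : ∀ x : {x : Stabilization A // 0 ≤ x},
      inducedTrace τB ⟨φ x.1, starHom_nonneg φ x.2⟩ = c * inducedTrace τA x)
    (x : {x : Stabilization A // 0 ≤ x}) :
    dimensionFunction τB ⟨φ x.1, starHom_nonneg φ x.2⟩ = c * dimensionFunction τA x := by
  unfold dimensionFunction
  rw [← ENNReal.limsup_const_mul_of_ne_top ENNReal.coe_ne_top]
  congr 1
  funext n
  rw [← h]
  congr 1
  exact Subtype.ext (starHom_nnrpow φ hφ x.2 _).symm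

/-- The pair `φ(h₁)`, `φ(h₂)` is a witness for the same ratio: hereditary range keeps the generated
subalgebras, and `c` cancels. -/
theorem fundamentalGroup_subset {τA : Trace A} {τB : Trace B}
    (φ : Stabilization A →⋆ₙₐ[ℂ] Stabilization B) (hφ : Function.Injective φ)
    (hr : HasHereditaryRange φ) {c : ℝ≥0} (hc : c ≠ 0)
    (h : ∀ x : {x : Stabilization A // 0 ≤ x},
      inducedTrace τB ⟨φ x.1, starHom_nonneg φ x.2⟩ = c * inducedTrace τA x) :
    fundamentalGroup τA ⊆ fundamentalGroup τB := by
  rintro r ⟨h₁, h₂, h₁0, h₂0, ⟨e⟩, hfin, hr'⟩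
  obtain ⟨e₁⟩ := nonempty_hereditary_equiv φ hφ hr h₁
  obtain ⟨e₂⟩ := nonempty_hereditary_equiv φ hφ hr h₂
  refine ⟨⟨φ h₁.1, starHom_nonneg φ h₁.2⟩, ⟨φ h₂.1, starHom_nonneg φ h₂.2⟩,
    (map_ne_zero_iff φ hφ).mpr h₁0, (map_ne_zero_iff φ hφ).mpr h₂0,
    ⟨(e₁.symm.trans e).trans e₂⟩, ?_, ?_⟩
  · rw [dimensionFunction_map φ hφ h]
    exact ENNReal.mul_lt_top ENNReal.coe_lt_top hfin
  · rw [dimensionFunction_map φ hφ h, dimensionFunction_map φ hφ h, hr',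
      ENNReal.mul_div_mul_left _ _ (ENNReal.coe_ne_zero.mpr hc) ENNReal.coe_ne_top]

end FundamentalGroup

namespace IsEquivalenceBimodule

variable {A B F : Type*}
    [NonUnitalCStarAlgebra A] [PartialOrder A] [StarOrderedRing A]
    [NonUnitalCStarAlgebra B] [PartialOrder B] [StarOrderedRing B]
    [NormedAddCommGroup F] [NormedSpace ℂ F] [CompleteSpace F] [SMul A F] [SMul Bᵐᵒᵖ F]
    [CStarModule A F] [CStarModule Bᵐᵒᵖ F]

/-- With `s = _A⟨f, f⟩^{1/2}` and `b = ⟨ζ, ζ⟩_A^{1/2}`, the left side is `τB(⟨b f, b f⟩_B) = c τA((b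
s)(b s)⋆)` and the right side is `c τA((b s)⋆(b s))`. -/
theorem trace_tensor (h : IsEquivalenceBimodule A B F) {τA : Trace A} {τB : Trace B} {c : ℝ≥0}
    (hc : ∀ f : F, τB ⟨unop (inner Bᵐᵒᵖ f f), unop_nonneg.mpr CStarModule.inner_self_nonneg⟩ =
      c * τA ⟨inner A f f, CStarModule.inner_self_nonneg⟩) (ζ : StandardModule A) (f : F) :
    τB ⟨unop (inner Bᵐᵒᵖ (h.tensor ζ f) (h.tensor ζ f)),
      unop_nonneg.mpr (CStarModule.inner_self_nonneg (A := Bᵐᵒᵖ) (E := HilbertSum Bᵐᵒᵖ F))⟩ =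
    c * τA ⟨unop (inner Aᵐᵒᵖ ((op (CFC.sqrt (inner A f f : A)) : Aᵐᵒᵖ) • ζ)
        ((op (CFC.sqrt (inner A f f : A)) : Aᵐᵒᵖ) • ζ)),
      unop_nonneg.mpr (CStarModule.inner_self_nonneg (A := Aᵐᵒᵖ) (E := StandardModule A))⟩ := by
  set s := CFC.sqrt (inner A f f : A)
  set b := CFC.sqrt (unop (inner Aᵐᵒᵖ ζ ζ) : A)
  have hs : star s = s := (IsSelfAdjoint.of_nonneg (CFC.sqrt_nonneg _)).star_eq
  have hb : star b = b := (IsSelfAdjoint.of_nonneg (CFC.sqrt_nonneg _)).star_eq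
  have hss : s * s = inner A f f := CFC.sqrt_mul_sqrt_self _ CStarModule.inner_self_nonneg
  have hbb : b * b = unop (inner Aᵐᵒᵖ ζ ζ) := CFC.sqrt_mul_sqrt_self _
    (unop_nonneg.mpr (CStarModule.inner_self_nonneg (A := Aᵐᵒᵖ) (E := StandardModule A)))
  have e1 : unop (inner Bᵐᵒᵖ (h.tensor ζ f) (h.tensor ζ f)) =
      unop (inner Bᵐᵒᵖ (b • f) (b • f)) := by
    rw [h.inner_tensor, ← hbb, op_mul_smul, h.inner_smul_left, hb]
  have e2 : (inner A (b • f) (b • f) : A) = b * s * star (b * s) := by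
    rw [CStarModule.inner_op_smul_right, CStarModule.inner_op_smul_left, ← hss, star_mul, hs]
    simp only [mul_assoc]
  have e3 : unop (inner Aᵐᵒᵖ ((op s : Aᵐᵒᵖ) • ζ) ((op s : Aᵐᵒᵖ) • ζ)) = star (b * s) * (b * s) := by
    rw [CStarModule.inner_op_smul_right (A := Aᵐᵒᵖ) (E := StandardModule A),
      CStarModule.inner_op_smul_left (A := Aᵐᵒᵖ) (E := StandardModule A), unop_mul, unop_mul,
      ← hbb, unop_star, unop_op, star_mul, hb]
    simp only [mul_assoc]
  rw [τB.congr _ e1, hc, τA.congr _ e2, τA.congr _ e3, τA.map_star_mul_self]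

/-- The induced traces on `A ⊗ 𝕂` and `B ⊗ 𝕂` agree up to a scalar under the embedding
`K(H_A) = K(F ⊕ F ⊕ ⋯) → K(H_B)`. -/
theorem inducedTrace_map (h : IsEquivalenceBimodule A B F) (hσA : IsSigmaUnital A)
    (hσB : IsSigmaUnital B) {τA : Trace A} {τB : Trace B} (hτA : LowerSemicontinuous τA)
    (hτB : LowerSemicontinuous τB) {c : ℝ≥0}
    (hc : ∀ f : F, τB ⟨unop (inner Bᵐᵒᵖ f f), unop_nonneg.mpr CStarModule.inner_self_nonneg⟩ =
      c * τA ⟨inner A f f, CStarModule.inner_self_nonneg⟩)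
    {φ : Stabilization A →⋆ₙₐ[ℂ] CompactOperators Bᵐᵒᵖ (HilbertSum Bᵐᵒᵖ F)}
    (hφ : Function.Injective φ)
    (hφθ : ∀ ζ ζ' f g, φ (theta Aᵐᵒᵖ ((op (inner A g f : A) : Aᵐᵒᵖ) • ζ) ζ') =
        theta Bᵐᵒᵖ (h.tensor ζ f) (h.tensor ζ' g))
    {V : HilbertSum Bᵐᵒᵖ F →ₗᵢ[ℂ] StandardModule B}
    (hV : ∀ x y, (inner Bᵐᵒᵖ (V x) (V y) : Bᵐᵒᵖ) = inner Bᵐᵒᵖ x y)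
    {α : CompactOperators Bᵐᵒᵖ (HilbertSum Bᵐᵒᵖ F) →⋆ₙₐ[ℂ] Stabilization B}
    (hα : Function.Injective α)
    (hαθ : ∀ ξ η, α (theta Bᵐᵒᵖ ξ η) = theta Bᵐᵒᵖ (V ξ) (V η))
    (x : {x : Stabilization A // 0 ≤ x}) :
    inducedTrace τB ⟨α (φ x.1), starHom_nonneg α (starHom_nonneg φ x.2)⟩ =
      c * inducedTrace τA x := by
  obtain ⟨p, hp, hsum⟩ := h.isConjCone_theta_tensor.exists_hasSum (starHom_nonneg φ x.2)
  choose ζ f hζf using hp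
  have hiso := NonUnitalStarAlgHom.isometry φ hφ
  have hcont := (NonUnitalStarAlgHom.isometry α hα).continuous
  -- Half of `_A⟨fⱼ, fⱼ⟩` is put on each side, so that the rank one operator of `ζⱼ ⊗ fⱼ` pulls back
  -- to a diagonal `θ_{yⱼ,yⱼ}`.
  let y : ℕ → StandardModule A := fun j => (op (CFC.sqrt (inner A (f j) (f j) : A)) : Aᵐᵒᵖ) • ζ j
  have hy : ∀ j, φ (theta Aᵐᵒᵖ (y j) (y j)) = p j := fun j => by
    have hs : star (CFC.sqrt (inner A (f j) (f j) : A)) = CFC.sqrt (inner A (f j) (f j) : A) :=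
      (IsSelfAdjoint.of_nonneg (CFC.sqrt_nonneg _)).star_eq
    rw [hζf, ← hφθ, ← CFC.sqrt_mul_sqrt_self (inner A (f j) (f j) : A)
      CStarModule.inner_self_nonneg, op_mul, op_mul_smul, theta_op_smul (op _) ((op _ : Aᵐᵒᵖ) • ζ j),
      ← op_star, hs]
  -- `φ` is isometric, so convergence of the image series gives convergence in `A ⊗ 𝕂`.
  have hsx : HasSum (fun j => theta Aᵐᵒᵖ (y j) (y j)) x.1 :=
    (hiso.isEmbedding.isInducing.hasSum_iff (g := φ) _ _).mp (hsum.congr_fun hy)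
  have hsB : HasSum (fun j => theta Bᵐᵒᵖ (V (h.tensor (ζ j) (f j))) (V (h.tensor (ζ j) (f j))))
      (α (φ x.1)) := by
    refine (hsum.map α hcont).congr_fun fun j => ?_
    rw [Function.comp_apply, hζf, hαθ]
  obtain ⟨ξA, hξA⟩ := exists_isCountableBasis_standardModule hσA
  obtain ⟨ξB, hξB⟩ := exists_isCountableBasis_standardModule hσB
  rw [inducedTrace_eq τA hτA hξA x hsx, inducedTrace_eq τB hτB hξB _ hsB, ← ENNReal.tsum_mul_left]
  refine tsum_congr fun j => ?_
  rw [← h.trace_tensor hc]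
  exact τB.congr _ (congrArg unop (hV _ _))

theorem fundamentalGroup_eq (h : IsEquivalenceBimodule A B F) (hσA : IsSigmaUnital A)
    (hσB : IsSigmaUnital B) {τA : Trace A} (hτA : τA.IsUnique) {τB : Trace B}
    (hτB : τB.IsUnique) : fundamentalGroup τA = fundamentalGroup τB := by
  obtain ⟨c, hc0, hc⟩ := h.exists_scalar hσA hτA hτB
  obtain ⟨φ, hφ, -, hφθ⟩ := h.exists_starHom_tensor
  obtain ⟨V, hV⟩ := h.exists_isometry_to_standardModule hσA
  obtain ⟨W, hW⟩ := h.exists_isometry_from_standardModule hσB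
  obtain ⟨α, hα, hαr, hαθ⟩ := exists_starHom_of_isometry V hV
  obtain ⟨β, hβ, hβr, hβθ⟩ := exists_starHom_of_isometry W hW
  have key := h.inducedTrace_map hσA hσB hτA.lowerSemicontinuous hτB.lowerSemicontinuous hc
    hφ.1 hφθ hV hα hαθ
  have hlscB := hτB.lowerSemicontinuous
  -- `α ∘ β` is induced by the isometry `V ∘ W` of `H_B` into itself, so it preserves each `⟨yⱼ,
  -- yⱼ⟩` and thus the induced trace.
  have hαβ : ∀ k : {k : Stabilization B // 0 ≤ k},
      inducedTrace τB ⟨α (β k.1), starHom_nonneg α (starHom_nonneg β k.2)⟩ =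
        inducedTrace τB k := fun k => by
    obtain ⟨p, hp, hsum⟩ := (isConjCone_theta Bᵐᵒᵖ (StandardModule B)).exists_hasSum k.2
    choose y hy using hp
    obtain rfl : p = fun j => theta Bᵐᵒᵖ (y j) (y j) := funext hy
    have hs := (hsum.map β (NonUnitalStarAlgHom.isometry β hβ).continuous).map α
      (NonUnitalStarAlgHom.isometry α hα).continuous
    have hs' : HasSum (fun j => theta Bᵐᵒᵖ (V (W (y j))) (V (W (y j)))) (α (β k.1)) :=
      hs.congr_fun fun j => by
        rw [Function.comp_apply, Function.comp_apply, hβθ, hαθ]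
    obtain ⟨ξB, hξB⟩ := exists_isCountableBasis_standardModule hσB
    rw [inducedTrace_eq τB hlscB hξB k hsum, inducedTrace_eq τB hlscB hξB _ hs']
    exact tsum_congr fun j => τB.congr _ (congrArg unop ((hV _ _).trans (hW _ _)))
  obtain ⟨ψ, hψ⟩ : ∃ ψ : CompactOperators Bᵐᵒᵖ (HilbertSum Bᵐᵒᵖ F) →⋆ₙₐ[ℂ] Stabilization A,
      ∀ T, φ (ψ T) = T := by
    let e := StarAlgEquiv.ofBijective φ hφ
    exact ⟨⟨⟨⟨⟨e.symm, map_smul e.symm⟩, map_zero e.symm, map_add e.symm⟩, map_mul e.symm⟩,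
      map_star e.symm⟩, e.apply_symm_apply⟩
  have hψi : Function.Injective ψ := Function.LeftInverse.injective hψ
  refine Set.Subset.antisymm
    (fundamentalGroup_subset (α.comp φ) (hα.comp hφ.1) (fun a a' d => ?_) hc0 key)
    (fundamentalGroup_subset (ψ.comp β) (hψi.comp hβ) (fun b b' d => ?_) (inv_ne_zero hc0)
      fun k => ?_)
  -- As `φ` is onto, `α ∘ φ` has the same hereditary range as `α`.
  · obtain ⟨T, hT⟩ := hαr (φ a) (φ a') d
    exact ⟨ψ T, (congrArg α (hψ T)).trans hT⟩
  · obtain ⟨T, hT⟩ := hβr b b' (φ d)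
    refine ⟨T, hφ.1 ?_⟩
    change φ (ψ (β T)) = φ (ψ (β b) * d * ψ (β b'))
    rw [hψ, hT, map_mul, map_mul, hψ, hψ]
  · have hk0 : 0 ≤ ψ (β k.1) := starHom_nonneg (ψ.comp β) k.2
    -- Following `ψ ∘ β` by `α ∘ φ` gives `α ∘ β`, which preserves the trace, while `α ∘ φ` scales
    -- it by `c`. Hence `ψ ∘ β` scales by `c⁻¹`.
    have hk' : inducedTrace τB k = c * inducedTrace τA ⟨ψ (β k.1), hk0⟩ := by
      rw [← hαβ, ← key]
      congr 1
      exact Subtype.ext (congrArg α (hψ _).symm)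
    rw [hk', ← mul_assoc, ← ENNReal.coe_mul, inv_mul_cancel₀ hc0, ENNReal.coe_one, one_mul]
    rfl

end IsEquivalenceBimodule

end CStarFund

theorem corollary4p5 {A : Type u} {B : Type v}
    [NonUnitalCStarAlgebra A] [PartialOrder A] [StarOrderedRing A]
    [NonUnitalCStarAlgebra B] [PartialOrder B] [StarOrderedRing B]
    (hA : CStarFund.IsSimpleCStar A) (hB : CStarFund.IsSimpleCStar B)
    (hσA : CStarFund.IsSigmaUnital A) (hσB : CStarFund.IsSigmaUnital B)
    (τA : CStarFund.Trace A) (hτA : τA.IsUnique) (τB : CStarFund.Trace B) (hτB : τB.IsUnique)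
    (hAB : CStarFund.MoritaEquivalent.{u, v, w} A B) :
    CStarFund.fundamentalGroup τA = CStarFund.fundamentalGroup τB := by
  obtain ⟨F, _, _, _, _, _, _, _, h⟩ := hAB
  exact h.fundamentalGroup_eq hσA hσB hτA hτB
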